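/- Let $f:\mathbb{R}^2\to\mathbb{R}$ be a stationary centred Gaussian field with covariance kernel $\kappa(x)=\mathbb{E}[f(0)f(x)]$, such that - $f$ is almost surely of class $C^3$; - for every $x\in\mathbb{R}^2\setminus\{0\}$ the Gaussian vector $(f(0),f(x),\nabla f(0),\nabla f(x))\in\mathbb{R}^6$ is non-degenerate; - $\kappa(x)\to 0$ as $|x|\to\infty$. For $R>0$ and $u\in C^2(\mathbb{R}^2)$, an $R$-saddle point of $u$ is a critical point $x$ of $u$ for which there exist four injective continuous paths $\gamma_1,\dots,\gamma_4$ from $x$ to the circle $\{y:|y-x|=R\}$, intersecting pairwise only at $x$, such that $u$ is constant on $\bigcup_i\gamma_i$. Then there exists $c>0$ (depending on $f$ but not on $R$) such that for every $R>0$ $$\mathbb{P}\big[\,f \text{ has an } R\text{-saddle point in } \{x:|x|\le 1\}\,\big] < \frac{c}{R}.$$ -/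

import Mathlib

open MeasureTheory ProbabilityTheory Filter Topology

noncomputable section

/-- The Euclidean plane. -/
abbrev Plane : Type := EuclideanSpace ℝ (Fin 2)

/-- `f : Plane → Ω → ℝ` is a stationary centred Gaussian field on the plane: its
finite-dimensional distributions are Gaussian, have mean zero, and are invariant under
translations. -/
structure IsStationaryCentredGaussianField {Ω : Type*} [MeasurableSpace Ω]
    (f : Plane → Ω → ℝ) (P : Measure Ω) : Prop where
  gaussian : IsGaussianProcess f P
  centred : ∀ x, ∫ ω, f x ω ∂P = 0
  stationary : ∀ (h : Plane) (I : Finset Plane),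
    P.map (fun ω (x : I) => f ((x : Plane) + h) ω) = P.map (fun ω (x : I) => f (x : Plane) ω)

/-- The covariance kernel `κ(x) = 𝔼[f(0) f(x)]`. -/
def covKernel {Ω : Type*} [MeasurableSpace Ω] (f : Plane → Ω → ℝ) (P : Measure Ω)
    (x : Plane) : ℝ :=
  ∫ ω, f 0 ω * f x ω ∂P

/-- The gradient at `x` of the realisation of the field `f` at `ω`. -/
def fieldGradient {Ω : Type*} (f : Plane → Ω → ℝ) (x : Plane) (ω : Ω) : Plane :=
  gradient (fun y => f y ω) x

/-- The random vector `(f(0), f(x), ∇₀f, ∇ₓf)` in `ℝ⁶`, by its coordinates. -/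
def valueGradientVector {Ω : Type*} (f : Plane → Ω → ℝ) (x : Plane) : Fin 6 → Ω → ℝ :=
  ![f 0, f x,
    fun ω => fieldGradient f 0 ω 0, fun ω => fieldGradient f 0 ω 1,
    fun ω => fieldGradient f x ω 0, fun ω => fieldGradient f x ω 1]

/-- A (Gaussian) random vector is non-degenerate if its covariance matrix is positive definite. -/
def IsNondegenerateVector {Ω : Type*} [MeasurableSpace Ω] {n : ℕ} (X : Fin n → Ω → ℝ)
    (P : Measure Ω) : Prop :=
  (Matrix.of fun i j => cov[X i, X j; P]).PosDef

/-- The smoothness, non-degeneracy and correlation decay assumptions on the field. -/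
structure SmoothNondegenerateDecaying {Ω : Type*} [MeasurableSpace Ω]
    (f : Plane → Ω → ℝ) (P : Measure Ω) : Prop where
  smooth : ∀ᵐ ω ∂P, ContDiff ℝ 3 (fun x => f x ω)
  nondegenerate : ∀ x : Plane, x ≠ 0 → IsNondegenerateVector (valueGradientVector f x) P
  decay : Tendsto (covKernel f P) (cocompact Plane) (𝓝 0)

/-- `x` is an `R`-saddle point of `u` (a function of class `C²`): it is a critical point of `u`
and there are four injective continuous paths from `x` to the circle of centre `x` and radius `R`,
which pairwise intersect only at `x`, on the union of which `u` is constant. -/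
def IsSaddlePoint (R : ℝ) (u : Plane → ℝ) (x : Plane) : Prop :=
  gradient u x = 0 ∧
    ∃ (y : Fin 4 → Plane) (γ : ∀ i, Path x (y i)),
      (∀ i, y i ∈ Metric.sphere x R) ∧
      (∀ i, Function.Injective (γ i)) ∧
      (∀ i j, i ≠ j → Set.range (γ i) ∩ Set.range (γ j) = {x}) ∧
      ∃ a : ℝ, ∀ z ∈ ⋃ i, Set.range (γ i), u z = a

end

/-!
A critical point with four branches of its level set reaching distance `R` is expensive: seen from a
circle of radius `ρ = R / 2` about the origin, each such point in the disc provides three points of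
the circle joined to each other inside the disc by a level set. Points of two different levels
cannot be interlaced on the circle, because two curves in a disc with interlaced end points meet
(`exists_eq_of_interlaced`). A non-crossing family of `k` triples cuts off `k` arcs with disjoint
interiors, each with end points in one of the triples (`exists_disjoint_intervals_of_noncrossing`).
Hence `k` star centres on distinct levels give `k` disjoint arcs of the circle at whose end points
the field takes equal values (`exists_disjoint_arcs_of_isStarCentre`). In each such arc the
tangential derivative takes both signs, at neighbouring points of every fine enough grid of the
circle. Such sign changes number `O(ρ)` in expectation: neighbouring tangential derivatives are
Gaussian variables whose difference has variance `O(ε²)`, with `ε` the distance of the points, and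
so have opposite signs with probability `O(ε)` (`measure_mul_neg_le`,
`exists_lintegral_le_of_disjoint_arcs`).

Place about `R²` disjoint unit discs in the disc of radius `ρ`. By stationarity the event that a
star of radius `R` is centred in a given one of them has the same probability `p` for all
(`starEvent_nullMeasurableSet_and_measure_eq`). Almost surely critical points in different discs
have different levels, since `(f(a) - f(b), ∇f(a), ∇f(b))` is a non-degenerate vector with five
coordinates depending on four parameters (`ae_level_ne_of_disjoint`). So `R² p = O(R)`, that is
`p = O(1 / R)` (`exists_sq_mul_measure_starEvent_le`).

The star event quantifies over uncountably many paths. It is null measurable, and its probability is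
determined by the law of the field, because it is a continuous image of a Borel set in the Polish
space of jets and paths, and analytic sets are universally measurable
(`AnalyticSet.nullMeasurableSet`).
-/

/-! ### Universal measurability of analytic sets -/

section

/-- The set of sequences bounded by a given sequence is compact. -/
lemma isCompact_setOf_le_nat (k : ℕ → ℕ) : IsCompact {x : ℕ → ℕ | ∀ i, x i ≤ k i} := by
  have : {x : ℕ → ℕ | ∀ i, x i ≤ k i} = Set.univ.pi fun i => Set.Iic (k i) := by
    ext x; simp only [Set.mem_univ_pi, Set.mem_Iic]; rfl
  rw [this]
  exact isCompact_univ_pi fun i => (Set.finite_Iic (k i)).isCompact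

/-- Analytic sets are universally measurable (Lusin): an analytic set contains compact sets whose
measures are arbitrarily close to its outer measure. -/
theorem MeasureTheory.AnalyticSet.nullMeasurableSet {X : Type*} [TopologicalSpace X] [T2Space X]
    [MeasurableSpace X] [BorelSpace X] {s : Set X} (hs : AnalyticSet s)
    (μ : Measure X) [IsFiniteMeasure μ] : NullMeasurableSet s μ := by
  rw [AnalyticSet] at hs
  rcases hs with rfl | ⟨g, hg, rfl⟩
  · exact MeasurableSet.empty.nullMeasurableSet
  -- `A k n` is the set of sequences whose first `n` terms are bounded by those of `k`
  let A : (ℕ → ℕ) → ℕ → Set (ℕ → ℕ) := fun k n => {x | ∀ i < n, x i ≤ k i}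
  have key : ∀ ε : ENNReal, ε ≠ 0 → ∃ K : Set X, IsCompact K ∧ K ⊆ Set.range g ∧
      μ (Set.range g) ≤ μ K + ε := by
    intro ε hε
    obtain ⟨δ, hδ, hδε⟩ := ENNReal.exists_pos_sum_of_countable hε ℕ
    have step : ∀ (B : Set (ℕ → ℕ)) (n : ℕ), ∃ m : ℕ,
        μ (g '' B) ≤ μ (g '' (B ∩ {x | x n ≤ m})) + δ n := by
      intro B n
      have hU : g '' B = ⋃ m, g '' (B ∩ {x | x n ≤ m}) := by
        rw [← Set.image_iUnion, ← Set.inter_iUnion]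
        congr 1
        ext x
        simp only [Set.mem_inter_iff, Set.mem_iUnion, Set.mem_ofPred_eq]
        exact ⟨fun h => ⟨h, x n, le_rfl⟩, fun h => h.1⟩
      have hmono : Monotone fun m => g '' (B ∩ {x | x n ≤ m}) := fun a b hab =>
        Set.image_mono (Set.inter_subset_inter_right _ fun x hx => le_trans hx hab)
      have hsup : μ (g '' B) = ⨆ m, μ (g '' (B ∩ {x | x n ≤ m})) := by
        conv_lhs => rw [hU]
        exact hmono.measure_iUnion
      by_contra! hcon
      have hfin : μ (g '' B) ≠ ⊤ := measure_ne_top _ _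
      have : μ (g '' B) + δ n ≤ μ (g '' B) := by
        conv_lhs => rw [hsup]
        rw [ENNReal.iSup_add]
        exact iSup_le fun m => (hcon m).le
      have h2 := ENNReal.le_of_add_le_add_left hfin (this.trans_eq (add_zero _).symm)
      exact (hδ n).ne' (by simpa using h2)
    choose m hm using step
    -- the bounds are chosen one coordinate after the other
    let B : ℕ → Set (ℕ → ℕ) := fun n => Nat.rec Set.univ (fun n S => S ∩ {x | x n ≤ m S n}) n
    have hBs : ∀ n, B (n + 1) = B n ∩ {x | x n ≤ m (B n) n} := fun n => rfl
    have hBn : ∀ n, μ (Set.range g) ≤ μ (g '' B n) + ∑ i ∈ Finset.range n, (δ i : ENNReal) := by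
      intro n
      induction n with
      | zero => simp [B]
      | succ n ih =>
        rw [Finset.sum_range_succ, hBs]
        calc μ (Set.range g) ≤ μ (g '' B n) + ∑ i ∈ Finset.range n, (δ i : ENNReal) := ih
          _ ≤ μ (g '' (B n ∩ {x | x n ≤ m (B n) n})) + δ n
              + ∑ i ∈ Finset.range n, (δ i : ENNReal) := by gcongr; exact hm _ _
          _ = _ := by rw [add_assoc, add_comm (δ n : ENNReal)]
    let k : ℕ → ℕ := fun n => m (B n) n
    have hBk : ∀ n, B n = {x | ∀ i < n, x i ≤ k i} := by
      intro n
      induction n with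
      | zero => ext; simp [B]
      | succ n ih =>
        rw [hBs, ih]
        ext x
        simp only [Set.mem_inter_iff, Set.mem_ofPred_eq, Nat.lt_succ_iff_lt_or_eq]
        constructor
        · rintro ⟨h1, h2⟩ i (hi | rfl)
          exacts [h1 i hi, by rw [← ih] at h2; exact h2]
        · intro h
          exact ⟨fun i hi => h i (.inl hi), by rw [← ih]; exact h n (.inr rfl)⟩
    let C : Set (ℕ → ℕ) := {x | ∀ i, x i ≤ k i}
    have hC : IsCompact C := isCompact_setOf_le_nat k
    refine ⟨g '' C, hC.image hg, Set.image_subset_range _ _, ?_⟩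
    -- every open neighbourhood of `g '' C` contains some `g '' B n`
    have hopen : ∀ U, IsOpen U → g '' C ⊆ U → ∃ n, g '' B n ⊆ U := by
      intro U hU hCU
      by_contra! hcon
      have hx : ∀ n, ∃ x ∈ B n, g x ∉ U := fun n => by
        obtain ⟨_, ⟨x, hx, rfl⟩, hxU⟩ := Set.not_subset.1 (hcon n)
        exact ⟨x, hx, hxU⟩
      choose x hxB hxU using hx
      let y : ℕ → ℕ → ℕ := fun n i => min (x n i) (k i)
      obtain ⟨z, hzC, φ, hφ, hz⟩ := hC.tendsto_subseq (x := y) fun n i => min_le_right _ _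
      have hxz : Tendsto (x ∘ φ) atTop (𝓝 z) := by
        rw [tendsto_pi_nhds] at hz ⊢
        intro i
        refine (hz i).congr' ?_
        filter_upwards [eventually_gt_atTop i] with n hn
        have h1 := hxB (φ n)
        rw [hBk] at h1
        exact min_eq_left (h1 i (hn.trans_le (hφ.id_le n)))
      have := ((hg.tendsto z).comp hxz).eventually (hU.mem_nhds (hCU ⟨z, hzC, rfl⟩))
      obtain ⟨n, hn⟩ := this.exists
      exact hxU _ hn
    have hInter : ⋂ n, closure (g '' B n) ⊆ g '' C := by
      intro z hz
      by_contra hzC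
      obtain ⟨U, V, hU, hV, hCU, hzV, hUV⟩ :=
        SeparatedNhds.of_isCompact_isCompact (hC.image hg) (isCompact_singleton (x := z))
          (Set.disjoint_singleton_right.2 hzC)
      obtain ⟨n, hn⟩ := hopen U hU hCU
      obtain ⟨w, hw1, hw2⟩ := mem_closure_iff.1 (Set.mem_iInter.1 hz n) V hV (hzV rfl)
      exact Set.disjoint_left.1 hUV (hn hw2) hw1
    have hanti : Antitone fun n => closure (g '' B n) := antitone_nat_of_succ_le fun n =>
      closure_mono (Set.image_mono (by rw [hBs]; exact Set.inter_subset_left))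
    have hinf : ⨅ n, μ (closure (g '' B n)) ≤ μ (g '' C) := by
      rw [← hanti.measure_iInter (fun n => isClosed_closure.measurableSet.nullMeasurableSet)
        ⟨0, measure_ne_top _ _⟩]
      exact measure_mono hInter
    have hn : ∀ n, μ (Set.range g) ≤ μ (closure (g '' B n)) + ε := fun n =>
      (hBn n).trans (add_le_add (measure_mono subset_closure)
        ((ENNReal.sum_le_tsum _).trans hδε.le))
    calc μ (Set.range g) ≤ (⨅ n, μ (closure (g '' B n))) + ε := by
          rw [ENNReal.iInf_add]; exact le_iInf hn
      _ ≤ _ := by gcongr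
  have hK : ∀ n : ℕ, ∃ K : Set X, IsCompact K ∧ K ⊆ Set.range g ∧
      μ (Set.range g) ≤ μ K + ((n : ENNReal) + 1)⁻¹ := fun n => key _ (by simp)
  choose K hKc hKs hKμ using hK
  have hL : MeasurableSet (⋃ n, K n) := .iUnion fun n => (hKc n).isClosed.measurableSet
  have hle : μ (Set.range g) ≤ μ (⋃ n, K n) := by
    have ht : Tendsto (fun n : ℕ => μ (⋃ n, K n) + ((n : ENNReal) + 1)⁻¹) atTop
        (𝓝 (μ (⋃ n, K n) + 0)) := by
      refine tendsto_const_nhds.add ?_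
      have := ENNReal.tendsto_inv_nat_nhds_zero.comp (tendsto_add_atTop_nat 1)
      simpa [Function.comp_def] using this
    rw [add_zero] at ht
    exact ge_of_tendsto' ht fun n => (hKμ n).trans (by gcongr; exact Set.subset_iUnion K n)
  exact hL.nullMeasurableSet.congr
    (ae_eq_of_subset_of_measure_ge (Set.iUnion_subset hKs) hle hL.nullMeasurableSet
      (measure_ne_top _ _))

end

/-! ### Curves in a disc with interlaced end points -/

section

/-- If `cos (g t - a)` never vanishes, the continuous angle `g` stays in an open interval of
length `π`. -/
lemma abs_sub_lt_pi_of_cos_ne_zero {g : ℝ → ℝ} (hg : Continuous g) {a : ℝ}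
    (h : ∀ t, Real.cos (g t - a) ≠ 0) (t₀ t₁ : ℝ) : |g t₁ - g t₀| < Real.pi := by
  by_contra! hcon
  wlog hle : g t₀ ≤ g t₁ generalizing t₀ t₁
  · exact this t₁ t₀ (by rwa [abs_sub_comm]) (le_of_not_ge hle)
  rw [abs_of_nonneg (sub_nonneg.2 hle)] at hcon
  have hpi := Real.pi_pos
  -- the first zero of `cos (· - a)` at or after `g t₀`
  set k : ℤ := ⌈(g t₀ - a - Real.pi / 2) / Real.pi⌉
  have h1 : (g t₀ - a - Real.pi / 2) / Real.pi ≤ k := Int.le_ceil _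
  have h2 : (k : ℝ) < (g t₀ - a - Real.pi / 2) / Real.pi + 1 := Int.ceil_lt_add_one _
  rw [div_le_iff₀ hpi] at h1
  have h2' : (k : ℝ) * Real.pi < (g t₀ - a - Real.pi / 2) + Real.pi := by
    have := mul_lt_mul_of_pos_right h2 hpi
    rwa [add_mul, div_mul_cancel₀ _ hpi.ne', one_mul] at this
  have hmem : a + Real.pi / 2 + k * Real.pi ∈ Set.Icc (g t₀) (g t₁) := by
    constructor <;> linarith
  obtain ⟨t, -, ht⟩ := intermediate_value_uIcc (a := t₀) (b := t₁) hg.continuousOn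
    (Set.Icc_subset_uIcc hmem)
  apply h t
  rw [ht, Real.cos_eq_zero_iff]
  exact ⟨k, by ring⟩

lemma exists_im_eq_of_exp_eq_sub {z : ℂ} {a b : ℝ} (hab : a < b) (hba : b < a + 2 * Real.pi)
    (hz : Complex.exp z = Complex.exp (a * Complex.I) - Complex.exp (b * Complex.I)) :
    ∃ k : ℤ, z.im = (a + b) / 2 - Real.pi / 2 + k * (2 * Real.pi) := by
  have hs : 0 < 2 * Real.sin ((b - a) / 2) := by
    have := Real.sin_pos_of_pos_of_lt_pi (x := (b - a) / 2) (by linarith) (by linarith)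
    linarith
  have key : Complex.exp (a * Complex.I) - Complex.exp (b * Complex.I)
      = Complex.exp ((Real.log (2 * Real.sin ((b - a) / 2)) : ℝ)
        + ((a + b) / 2 - Real.pi / 2 : ℝ) * Complex.I) := by
    rw [Complex.exp_add, ← Complex.ofReal_exp, Real.exp_log hs]
    have e1 : (a : ℂ) * Complex.I
        = ((a + b) / 2 : ℝ) * Complex.I + (-((b - a) / 2 : ℝ)) * Complex.I := by
      push_cast; ring
    have e2 : (b : ℂ) * Complex.I
        = ((a + b) / 2 : ℝ) * Complex.I + ((b - a) / 2 : ℝ) * Complex.I := by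
      push_cast; ring
    have e3 : (((a + b) / 2 - Real.pi / 2 : ℝ) : ℂ) * Complex.I
        = ((a + b) / 2 : ℝ) * Complex.I + (-(Real.pi / 2 * Complex.I)) := by
      push_cast; ring
    rw [e1, e2, e3, Complex.exp_add, Complex.exp_add, Complex.exp_add, Complex.exp_neg,
      Complex.exp_pi_div_two_mul_I, Complex.exp_mul_I, Complex.exp_mul_I, Complex.exp_mul_I,
      Complex.cos_neg, Complex.sin_neg, Complex.inv_I]
    push_cast
    ring
  rw [key, Complex.exp_eq_exp_iff_exists_int] at hz
  obtain ⟨k, hk⟩ := hz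
  refine ⟨k, ?_⟩
  have := congrArg Complex.im hk
  simpa using this

/-- A nonzero chord from a boundary point of the unit disc into the disc makes an acute angle with
the inner normal. -/
lemma re_conj_mul_sub_pos {p y : ℂ} (hp : ‖p‖ = 1) (hy : ‖y‖ ≤ 1) (hne : p ≠ y) :
    0 < (starRingEnd ℂ p * (p - y)).re := by
  have h1 : p.re ^ 2 + p.im ^ 2 = 1 := by
    have := Complex.sq_norm p; rw [hp, Complex.normSq_apply] at this; nlinarith
  have h2 : y.re ^ 2 + y.im ^ 2 ≤ 1 := by
    have := Complex.sq_norm y; rw [Complex.normSq_apply] at this; nlinarith [norm_nonneg y]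
  have h3 : 0 < (p.re - y.re) ^ 2 + (p.im - y.im) ^ 2 := by
    by_contra! hcon
    apply hne
    apply Complex.ext <;> nlinarith [sq_nonneg (p.re - y.re), sq_nonneg (p.im - y.im)]
  simp only [Complex.mul_re, Complex.conj_re, Complex.conj_im, Complex.sub_re, Complex.sub_im]
  nlinarith

lemma cos_im_sub_ne_zero {z p y : ℂ} {a : ℝ} (hp : p = Complex.exp (a * Complex.I))
    (hy : ‖y‖ ≤ 1) (hz : Complex.exp z = p - y ∨ Complex.exp z = y - p) :
    Real.cos (z.im - a) ≠ 0 := by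
  have hp1 : ‖p‖ = 1 := by rw [hp, Complex.norm_exp_ofReal_mul_I]
  have hne : p ≠ y := by
    rintro rfl
    rcases hz with hz | hz <;> exact Complex.exp_ne_zero z (by rw [hz, sub_self])
  have h := re_conj_mul_sub_pos hp1 hy hne
  have hE : (starRingEnd ℂ p * Complex.exp z).re = Real.exp z.re * Real.cos (z.im - a) := by
    rw [hp, ← Complex.exp_conj, ← Complex.exp_add, Complex.exp_re]
    congr 2 <;> simp
    ring
  intro h0
  rw [h0, mul_zero] at hE
  rcases hz with hz | hz
  · rw [hz] at hE; exact h.ne' hE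
  · rw [hz, ← neg_sub, mul_neg, Complex.neg_re] at hE; linarith

/-- Two paths in the closed unit disc whose endpoints on the unit circle are interlaced intersect.

Otherwise the difference of the two paths, as a function on the square of parameters, has a
continuous logarithm; its imaginary part changes by less than `π` along each side of the square,
so its changes along the sides are determined by the corners, and they do not add up. -/
theorem exists_eq_of_interlaced {α β : ℝ → ℂ} (hα : Continuous α) (hβ : Continuous β)
    (hα1 : ∀ s, ‖α s‖ ≤ 1) (hβ1 : ∀ t, ‖β t‖ ≤ 1) {s₁ t₁ s₂ t₂ : ℝ}
    (h1 : s₁ < t₁) (h2 : t₁ < s₂) (h3 : s₂ < t₂) (h4 : t₂ < s₁ + 2 * Real.pi)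
    (hα0 : α 0 = Complex.exp (s₁ * Complex.I)) (hαe : α 1 = Complex.exp (s₂ * Complex.I))
    (hβ0 : β 0 = Complex.exp (t₁ * Complex.I)) (hβe : β 1 = Complex.exp (t₂ * Complex.I)) :
    ∃ s t, α s = β t := by
  by_contra! hne
  have hpi := Real.pi_pos
  let F : C(ℝ × ℝ, ℂ) := ⟨fun p => α p.1 - β p.2, by fun_prop⟩
  have hF : ∀ p, F p ∈ ({0}ᶜ : Set ℂ) := fun p => sub_ne_zero.2 (hne p.1 p.2)
  obtain ⟨G, ⟨-, hG⟩, -⟩ := Complex.isCoveringMapOn_exp.existsUnique_continuousMap_lifts F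
    (a₀ := (0, 0)) (e₀ := Complex.log (F (0, 0))) (Complex.exp_log (hF _)) hF
  have hG' : ∀ s t, Complex.exp (G (s, t)) = α s - β t := fun s t => congrFun hG (s, t)
  have hcont : Continuous fun p : ℝ × ℝ => (G p).im := Complex.continuous_im.comp G.continuous
  have E1 := abs_sub_lt_pi_of_cos_ne_zero (g := fun t => (G (0, t)).im) (a := s₁)
    (hcont.comp (by fun_prop : Continuous fun t : ℝ => ((0 : ℝ), t)))
    (fun t => cos_im_sub_ne_zero hα0 (hβ1 t) (.inl (hG' 0 t))) 0 1
  have E2 := abs_sub_lt_pi_of_cos_ne_zero (g := fun t => (G (1, t)).im) (a := s₂)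
    (hcont.comp (by fun_prop : Continuous fun t : ℝ => ((1 : ℝ), t)))
    (fun t => cos_im_sub_ne_zero hαe (hβ1 t) (.inl (hG' 1 t))) 0 1
  have E3 := abs_sub_lt_pi_of_cos_ne_zero (g := fun s => (G (s, 0)).im) (a := t₁)
    (hcont.comp (by fun_prop : Continuous fun s : ℝ => (s, (0 : ℝ))))
    (fun s => cos_im_sub_ne_zero hβ0 (hα1 s) (.inr (hG' s 0))) 0 1
  have E4 := abs_sub_lt_pi_of_cos_ne_zero (g := fun s => (G (s, 1)).im) (a := t₂)
    (hcont.comp (by fun_prop : Continuous fun s : ℝ => (s, (1 : ℝ))))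
    (fun s => cos_im_sub_ne_zero hβe (hα1 s) (.inr (hG' s 1))) 0 1
  obtain ⟨k₁, hk₁⟩ := exists_im_eq_of_exp_eq_sub (z := G (0, 0)) h1 (by linarith)
    (by rw [hG', hα0, hβ0])
  obtain ⟨k₂, hk₂⟩ := exists_im_eq_of_exp_eq_sub (z := G (0, 1)) (a := s₁) (b := t₂) (by linarith)
    (by linarith) (by rw [hG', hα0, hβe])
  obtain ⟨k₃, hk₃⟩ := exists_im_eq_of_exp_eq_sub (z := G (1, 1)) h3 (by linarith)
    (by rw [hG', hαe, hβe])
  obtain ⟨k₄, hk₄⟩ := exists_im_eq_of_exp_eq_sub (z := G (1, 0) + Real.pi * Complex.I) h2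
    (by linarith) (by rw [Complex.exp_add, Complex.exp_pi_mul_I, hG', hαe, hβ0]; ring)
  simp only [Complex.add_im, Complex.mul_im, Complex.ofReal_re, Complex.ofReal_im, Complex.I_re,
    Complex.I_im] at hk₄
  simp only [abs_lt] at E1 E2 E3 E4
  -- the windings along the four sides
  have I1 : (k₂ : ℤ) - k₁ = 0 := by
    have a1 : (k₂ : ℝ) - k₁ < 1 := by nlinarith
    have a2 : (-1 : ℝ) < k₂ - k₁ := by nlinarith
    have b1 : k₂ - k₁ < 1 := by exact_mod_cast a1
    have b2 : -1 < k₂ - k₁ := by exact_mod_cast a2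
    omega
  have I2 : (k₃ : ℤ) - k₂ = 0 := by
    have a1 : (k₃ : ℝ) - k₂ < 1 := by nlinarith
    have a2 : (-1 : ℝ) < k₃ - k₂ := by nlinarith
    have b1 : k₃ - k₂ < 1 := by exact_mod_cast a1
    have b2 : -1 < k₃ - k₂ := by exact_mod_cast a2
    omega
  have I3 : (k₃ : ℤ) - k₄ = -1 := by
    have a1 : (k₃ : ℝ) - k₄ < 0 := by nlinarith
    have a2 : (-2 : ℝ) < k₃ - k₄ := by nlinarith
    have b1 : k₃ - k₄ < 0 := by exact_mod_cast a1
    have b2 : -2 < k₃ - k₄ := by exact_mod_cast a2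
    omega
  have I4 : (k₄ : ℤ) - k₁ = 0 := by
    have a1 : (k₄ : ℝ) - k₁ < 1 := by nlinarith
    have a2 : (-1 : ℝ) < k₄ - k₁ := by nlinarith
    have b1 : k₄ - k₁ < 1 := by exact_mod_cast a1
    have b2 : -1 < k₄ - k₁ := by exact_mod_cast a2
    omega
  omega

end

/-! ### Non-crossing triples on a line -/

section

/-- Non-crossing families of triples on a line, on each of which a function `h` is constant, have
at least as many pairwise non-overlapping intervals with equal values of `h` at both ends as they
have members.

A triple with minimal hull contains no point of another triple in its hull, so it contributes its
two consecutive gaps, and at most one of the intervals obtained from the remaining triples, one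
that contains the hull, has to be given up. -/
theorem exists_disjoint_intervals_of_noncrossing {ι : Type*} (h : ℝ → ℝ)
    (p q r : ι → ℝ) (S : Finset ι) (hpq : ∀ i ∈ S, p i < q i) (hqr : ∀ i ∈ S, q i < r i)
    (hpq' : ∀ i ∈ S, h (p i) = h (q i)) (hqr' : ∀ i ∈ S, h (q i) = h (r i))
    (hcross : ∀ i ∈ S, ∀ j ∈ S, i ≠ j → ∀ s ∈ ({p j, q j, r j} : Set ℝ),
      ∀ t ∈ ({p j, q j, r j} : Set ℝ), p i ≤ s → s ≤ r i → p i < t ∧ t < r i) :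
    ∃ J : Finset (ℝ × ℝ), S.card ≤ J.card ∧
      (∀ I ∈ J, I.1 < I.2 ∧ h I.1 = h I.2 ∧
        (∃ i ∈ S, I.1 ∈ ({p i, q i, r i} : Set ℝ)) ∧ ∃ i ∈ S, I.2 ∈ ({p i, q i, r i} : Set ℝ)) ∧
      (∀ I ∈ J, ∀ I' ∈ J, I ≠ I' → Disjoint (Set.Ioo I.1 I.2) (Set.Ioo I'.1 I'.2)) := by
  classical
  induction hn : S.card generalizing S with
  | zero => exact ⟨∅, by simp, by simp, by simp⟩
  | succ n ih =>
    have hne : S.Nonempty := Finset.card_pos.1 (by omega)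
    -- a triple whose hull has minimal length
    obtain ⟨i, hi, hmin⟩ := S.exists_min_image (fun i => r i - p i) hne
    have hout : ∀ j ∈ S, j ≠ i → ∀ s ∈ ({p j, q j, r j} : Set ℝ), s < p i ∨ r i < s := by
      intro j hj hji s hs
      by_contra! hcon
      have hP := hcross i hi j hj hji.symm s hs (p j) (by simp) hcon.1 hcon.2
      have hR := hcross i hi j hj hji.symm s hs (r j) (by simp) hcon.1 hcon.2
      have hm := hmin j hj
      linarith [hP.1, hR.2]
    have hsub : ∀ j ∈ S.erase i, j ∈ S := fun j hj => Finset.mem_of_mem_erase hj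
    obtain ⟨J, hJc, hJ, hJd⟩ := ih (S.erase i) (fun j hj => hpq j (hsub j hj))
      (fun j hj => hqr j (hsub j hj)) (fun j hj => hpq' j (hsub j hj))
      (fun j hj => hqr' j (hsub j hj))
      (fun j hj k hk => hcross j (hsub j hj) k (hsub k hk))
      (by rw [Finset.card_erase_of_mem hi, hn]; rfl)
    have hp1 := hpq i hi
    have hq1 := hqr i hi
    have hends : ∀ I ∈ J, (I.1 < p i ∨ r i < I.1) ∧ (I.2 < p i ∨ r i < I.2) := by
      intro I hI
      obtain ⟨-, -, ⟨j, hj, hj1⟩, ⟨k, hk, hk1⟩⟩ := hJ I hI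
      exact ⟨hout j (hsub j hj) (Finset.ne_of_mem_erase hj) _ hj1,
        hout k (hsub k hk) (Finset.ne_of_mem_erase hk) _ hk1⟩
    let Bad : ℝ × ℝ → Prop := fun I => I.1 < p i ∧ r i < I.2
    have hgood : ∀ I ∈ J, ¬ Bad I → I.2 < p i ∨ r i < I.1 := by
      intro I hI hb
      have h12 := (hJ I hI).1
      rcases hends I hI with ⟨h1 | h1, h2 | h2⟩
      · exact .inl h2
      · exact absurd ⟨h1, h2⟩ hb
      · exact .inr h1
      · exact .inr h1
    have hbad1 : (J.filter Bad).card ≤ 1 := by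
      rw [Finset.card_le_one]
      intro I hI I' hI'
      rw [Finset.mem_filter] at hI hI'
      by_contra hII
      have := hJd I hI.1 I' hI'.1 hII
      exact Set.disjoint_left.1 this
        (show q i ∈ _ from ⟨by linarith [hI.2.1], by linarith [hI.2.2]⟩)
        ⟨by linarith [hI'.2.1], by linarith [hI'.2.2]⟩
    have hcard : (J.filter Bad).card + (J.filter (fun I => ¬ Bad I)).card = J.card :=
      Finset.card_filter_add_card_filter_not _
    let J' := J.filter (fun I => ¬ Bad I)
    have hJ' : ∀ I ∈ J', I ∈ J ∧ (I.2 < p i ∨ r i < I.1) := fun I hI =>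
      ⟨(Finset.mem_filter.1 hI).1, hgood I (Finset.mem_filter.1 hI).1 (Finset.mem_filter.1 hI).2⟩
    have hn1 : (p i, q i) ∉ insert (q i, r i) J' := by
      rw [Finset.mem_insert, not_or]
      refine ⟨fun he => ?_, fun hm => ?_⟩
      · exact hp1.ne (congrArg Prod.fst he)
      · rcases (hJ' _ hm).2 with h1 | h1 <;> simp only at h1 <;> linarith
    have hn2 : (q i, r i) ∉ J' := by
      intro hm
      rcases (hJ' _ hm).2 with h1 | h1 <;> simp only at h1 <;> linarith
    refine ⟨insert (p i, q i) (insert (q i, r i) J'), ?_, ?_, ?_⟩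
    · rw [Finset.card_insert_of_notMem hn1, Finset.card_insert_of_notMem hn2]
      have : J'.card = (J.filter (fun I => ¬ Bad I)).card := rfl
      omega
    · intro I hI
      rw [Finset.mem_insert, Finset.mem_insert] at hI
      rcases hI with rfl | rfl | hI
      · exact ⟨hp1, hpq' i hi, ⟨i, hi, by simp⟩, ⟨i, hi, by simp⟩⟩
      · exact ⟨hq1, hqr' i hi, ⟨i, hi, by simp⟩, ⟨i, hi, by simp⟩⟩
      · obtain ⟨a1, a2, ⟨j, hj, hj1⟩, ⟨k, hk, hk1⟩⟩ := hJ I (hJ' I hI).1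
        exact ⟨a1, a2, ⟨j, hsub j hj, hj1⟩, ⟨k, hsub k hk, hk1⟩⟩
    · have d1 : Disjoint (Set.Ioo (p i) (q i)) (Set.Ioo (q i) (r i)) :=
        Set.disjoint_left.2 fun x hx hx' => (hx.2.trans hx'.1).false
      have d2 : ∀ I ∈ J', ∀ a b, p i ≤ a → b ≤ r i →
          Disjoint (Set.Ioo a b) (Set.Ioo I.1 I.2) := by
        intro I hI a b ha hb
        refine Set.disjoint_left.2 fun x hx hx' => ?_
        rcases (hJ' _ hI).2 with h1 | h1
        · linarith [hx.1, hx'.2]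
        · linarith [hx.2, hx'.1]
      intro I hI I' hI' hII
      rw [Finset.mem_insert, Finset.mem_insert] at hI hI'
      rcases hI with rfl | rfl | hI <;> rcases hI' with rfl | rfl | hI'
      · exact absurd rfl hII
      · exact d1
      · exact d2 I' hI' _ _ le_rfl hq1.le
      · exact d1.symm
      · exact absurd rfl hII
      · exact d2 I' hI' _ _ hp1.le le_rfl
      · exact (d2 I hI _ _ le_rfl hq1.le).symm
      · exact (d2 I hI _ _ hp1.le le_rfl).symm
      · exact hJd I (hJ' I hI).1 I' (hJ' I' hI').1 hII

end

/-! ### Centred Gaussian variables -/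

section

/-- A real random variable is centred Gaussian if its law is Gaussian, possibly degenerate, with
mean zero. -/
structure IsCentredGaussian {Ω : Type*} [MeasurableSpace Ω] (X : Ω → ℝ) (P : Measure Ω) :
    Prop where
  hasGaussianLaw : HasGaussianLaw X P
  integral_eq_zero : ∫ ω, X ω ∂P = 0

namespace IsCentredGaussian

variable {Ω : Type*} [MeasurableSpace Ω] {P : Measure Ω} {X : Ω → ℝ}

lemma aemeasurable (hX : IsCentredGaussian X P) : AEMeasurable X P :=
  hX.hasGaussianLaw.aemeasurable

lemma congr {Y : Ω → ℝ} (hX : IsCentredGaussian X P) (h : X =ᵐ[P] Y) : IsCentredGaussian Y P :=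
  ⟨hX.hasGaussianLaw.congr h, by rw [← integral_congr_ae h, hX.integral_eq_zero]⟩

lemma integral_exp (hX : IsCentredGaussian X P) (t : ℝ) :
    ∫ ω, Complex.exp (t * X ω * Complex.I) ∂P = (Real.exp (-Var[X; P] * t ^ 2 / 2) : ℝ) := by
  have h := charFun_gaussianReal (μ := 0) (v := Var[X; P].toNNReal) t
  have hm := hX.hasGaussianLaw.map_eq_gaussianReal
  rw [hX.integral_eq_zero] at hm
  rw [← hm, charFun_apply_real, integral_map hX.aemeasurable (by fun_prop)] at h
  rw [h, Complex.ofReal_exp, Real.coe_toNNReal _ (variance_nonneg _ _)]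
  congr 1
  push_cast
  ring

lemma of_integral_exp [IsProbabilityMeasure P] (hX : AEMeasurable X P) {v : ℝ} (hv : 0 ≤ v)
    (h : ∀ t : ℝ, ∫ ω, Complex.exp (t * X ω * Complex.I) ∂P = (Real.exp (-v * t ^ 2 / 2) : ℝ)) :
    IsCentredGaussian X P ∧ Var[X; P] = v := by
  have : IsProbabilityMeasure (P.map X) := Measure.isProbabilityMeasure_map hX
  have hm : P.map X = gaussianReal 0 v.toNNReal := by
    apply Measure.ext_of_charFun
    ext t
    rw [charFun_gaussianReal, charFun_apply_real, integral_map hX (by fun_prop), h,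
      Complex.ofReal_exp, Real.coe_toNNReal _ hv]
    congr 1
    push_cast
    ring
  refine ⟨⟨⟨by rw [hm]; infer_instance⟩, ?_⟩, ?_⟩
  · have := integral_map hX (f := fun x : ℝ => x) (by fun_prop)
    rw [← this, hm, integral_id_gaussianReal]
  · have := variance_map (X := fun x : ℝ => x) (Y := X) (μ := P) (by fun_prop) hX
    rw [hm, variance_fun_id_gaussianReal, Real.coe_toNNReal _ hv] at this
    exact this.symm

/-- Almost sure limits of centred Gaussian variables are centred Gaussian, and the variances
converge. -/
theorem of_tendsto [IsProbabilityMeasure P] {Xs : ℕ → Ω → ℝ}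
    (hXs : ∀ n, IsCentredGaussian (Xs n) P)
    (h : ∀ᵐ ω ∂P, Tendsto (fun n => Xs n ω) atTop (𝓝 (X ω))) :
    IsCentredGaussian X P ∧ Tendsto (fun n => Var[Xs n; P]) atTop (𝓝 Var[X; P]) := by
  have hXm : AEMeasurable X P :=
    aemeasurable_of_tendsto_metrizable_ae' (fun n => (hXs n).aemeasurable) h
  let φ : ℝ → ℂ := fun t => ∫ ω, Complex.exp (t * X ω * Complex.I) ∂P
  have hnorm : ∀ (t : ℝ) (x : ℝ), ‖Complex.exp (t * x * Complex.I)‖ = 1 := fun t x => by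
    rw [← Complex.ofReal_mul, Complex.norm_exp_ofReal_mul_I]
  have hφ : ∀ t : ℝ, Tendsto (fun n => ((Real.exp (-Var[Xs n; P] * t ^ 2 / 2) : ℝ) : ℂ)) atTop
      (𝓝 (φ t)) := by
    intro t
    simp_rw [← fun n => (hXs n).integral_exp t]
    refine tendsto_integral_of_dominated_convergence (fun _ => (1 : ℝ)) (fun n => ?_)
      (integrable_const _) (fun n => ae_of_all _ fun ω => (hnorm _ _).le) ?_
    · have := (hXs n).aemeasurable
      exact AEMeasurable.aestronglyMeasurable (by fun_prop)
    · filter_upwards [h] with ω hω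
      have hc : Continuous fun x : ℝ => Complex.exp (t * x * Complex.I) := by fun_prop
      exact (hc.tendsto _).comp hω
  have hφre : ∀ t : ℝ, Tendsto (fun n => Real.exp (-Var[Xs n; P] * t ^ 2 / 2)) atTop
      (𝓝 (φ t).re) := fun t => by
    simpa only [Complex.ofReal_re, Function.comp_def] using
      (Complex.continuous_re.tendsto _).comp (hφ t)
  have hφim : ∀ t : ℝ, φ t = ((φ t).re : ℝ) := fun t =>
    tendsto_nhds_unique (hφ t) ((Complex.continuous_ofReal.tendsto _).comp (hφre t))
  have hφ0 : Tendsto (fun n : ℕ => φ (1 / ((n : ℝ) + 1))) atTop (𝓝 1) := by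
    have : (1 : ℂ) = ∫ _, (1 : ℂ) ∂P := by simp
    rw [this]
    refine tendsto_integral_of_dominated_convergence (fun _ => (1 : ℝ)) (fun n => ?_)
      (integrable_const _) (fun n => ae_of_all _ fun ω => (hnorm _ _).le) (ae_of_all _ fun ω => ?_)
    · exact AEMeasurable.aestronglyMeasurable (by fun_prop)
    · have hc : Continuous fun t : ℝ => Complex.exp (t * X ω * Complex.I) := by fun_prop
      have := (hc.tendsto 0).comp (tendsto_one_div_add_atTop_nhds_zero_nat (𝕜 := ℝ))
      simpa [Function.comp_def] using this
  -- the characteristic function of the limit is nonzero at some `t ≠ 0`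
  obtain ⟨m, hm⟩ : ∃ m : ℕ, 0 < (φ (1 / ((m : ℝ) + 1))).re := by
    have := ((Complex.continuous_re.tendsto _).comp hφ0).eventually (lt_mem_nhds (a := 0) (by simp))
    exact this.exists
  set t₀ : ℝ := 1 / ((m : ℝ) + 1)
  have ht₀ : 0 < t₀ := by positivity
  set v : ℝ := -2 * Real.log (φ t₀).re / t₀ ^ 2
  have hvar : Tendsto (fun n => Var[Xs n; P]) atTop (𝓝 v) := by
    have h1 := ((Real.continuousAt_log hm.ne').tendsto.comp (hφre t₀)).const_mul (-2)
    have h2 := h1.div_const (t₀ ^ 2)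
    refine h2.congr fun n => ?_
    simp only [Function.comp, Real.log_exp]
    field_simp
  have hv : 0 ≤ v := ge_of_tendsto' hvar fun n => variance_nonneg _ _
  obtain ⟨h1, h2⟩ := of_integral_exp hXm hv fun t => by
    have e1 : Tendsto (fun n => Real.exp (-Var[Xs n; P] * t ^ 2 / 2)) atTop
        (𝓝 (Real.exp (-v * t ^ 2 / 2))) := by
      have hc : Continuous fun w : ℝ => Real.exp (-w * t ^ 2 / 2) := by fun_prop
      exact (hc.tendsto v).comp hvar
    have e2 := tendsto_nhds_unique (hφre t) e1
    change φ t = _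
    rw [hφim t, e2]
  exact ⟨h1, by rwa [h2]⟩

lemma const_mul (hX : IsCentredGaussian X P) (c : ℝ) :
    IsCentredGaussian (fun ω => c * X ω) P :=
  ⟨hX.hasGaussianLaw.fun_smul c, by rw [integral_const_mul, hX.integral_eq_zero, mul_zero]⟩

end IsCentredGaussian

/-- The Gaussian integral behind the small ball estimate. -/
lemma integral_exp_neg_mul_sq_gaussianReal_le {a : ℝ} (ha : 0 < a) :
    ∫ x, Real.exp (-a * x ^ 2 / 2) ∂(gaussianReal 0 1) ≤ (Real.sqrt a)⁻¹ := by
  rw [integral_gaussianReal_eq_integral_smul (by norm_num)]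
  have h1 : ∀ x : ℝ, gaussianPDFReal 0 1 x • Real.exp (-a * x ^ 2 / 2)
      = (Real.sqrt (2 * Real.pi))⁻¹ * Real.exp (-((1 + a) / 2) * x ^ 2) := fun x => by
    rw [gaussianPDFReal_def, smul_eq_mul]
    simp only [NNReal.coe_one, mul_one, sub_zero]
    rw [mul_assoc, ← Real.exp_add]
    congr 2
    ring
  simp_rw [h1]
  rw [integral_const_mul, integral_gaussian, ← Real.sqrt_inv, ← Real.sqrt_inv,
    ← Real.sqrt_mul (by positivity)]
  apply Real.sqrt_le_sqrt
  have : (2 * Real.pi)⁻¹ * (Real.pi / ((1 + a) / 2)) = (1 + a)⁻¹ := by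
    field_simp
  rw [this]
  exact inv_anti₀ ha (by linarith)

/-- Small ball estimate for Gaussian vectors: a centred Gaussian vector in `ℝᵐ` whose covariance
matrix is at least `lam` lies in the cube of half-side `δ` with probability `O((δ / √lam)ᵐ)`.

The indicator of the cube is bounded by a Gaussian function, which is the characteristic function
of an independent Gaussian vector; by Fubini, its expectation is an average of the characteristic
function of the given vector. -/
theorem measure_forall_abs_le_le {Ω : Type*} [MeasurableSpace Ω] {P : Measure Ω}
    [IsProbabilityMeasure P] {m : ℕ} {X : Fin m → Ω → ℝ} {lam δ : ℝ} (hlam : 0 < lam) (hδ : 0 < δ)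
    (hX : ∀ i, AEMeasurable (X i) P)
    (hG : ∀ ξ : Fin m → ℝ, IsCentredGaussian (fun ω => ∑ i, ξ i * X i ω) P)
    (hV : ∀ ξ : Fin m → ℝ, lam * ∑ i, ξ i ^ 2 ≤ Var[fun ω => ∑ i, ξ i * X i ω; P]) :
    P.real {ω | ∀ i, |X i ω| ≤ δ} ≤ Real.exp (m / 2) * (δ / Real.sqrt lam) ^ m := by
  let N : Measure (Fin m → ℝ) := Measure.pi fun _ => gaussianReal 0 1
  let Φ : Ω → (Fin m → ℝ) → ℂ := fun ω ξ =>
    Complex.exp ((δ⁻¹ : ℝ) * ((∑ i, ξ i * X i ω : ℝ) : ℂ) * Complex.I)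
  let g : Ω → ℝ := fun ω => Real.exp (-(∑ i, X i ω ^ 2) / (2 * δ ^ 2))
  have hg : ∀ ω, ∫ ξ, Φ ω ξ ∂N = (g ω : ℝ) := by
    intro ω
    have e1 : ∀ ξ : Fin m → ℝ, Φ ω ξ
        = ∏ i, Complex.exp (((δ⁻¹ * X i ω : ℝ) : ℂ) * (ξ i : ℂ) * Complex.I) := fun ξ => by
      rw [← Complex.exp_sum]
      simp only [Φ]
      congr 1
      push_cast
      rw [Finset.mul_sum, Finset.sum_mul]
      exact Finset.sum_congr rfl fun i _ => by ring
    simp_rw [e1]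
    rw [integral_fintype_prod_eq_prod
      (f := fun i (x : ℝ) => Complex.exp (((δ⁻¹ * X i ω : ℝ) : ℂ) * (x : ℂ) * Complex.I))]
    simp_rw [← charFun_apply_real, charFun_gaussianReal]
    rw [← Complex.exp_sum]
    simp only [g]
    rw [Complex.ofReal_exp]
    congr 1
    push_cast
    rw [← Finset.sum_neg_distrib, Finset.sum_div]
    refine Finset.sum_congr rfl fun i _ => ?_
    have : (δ : ℂ) ≠ 0 := by exact_mod_cast hδ.ne'
    field_simp
    ring
  have hint : Integrable (Function.uncurry Φ) (P.prod N) := by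
    refine (integrable_const (1 : ℝ)).mono' ?_ (ae_of_all _ fun p => ?_)
    · have h1 : ∀ i, AEMeasurable (fun p : Ω × (Fin m → ℝ) => X i p.1) (P.prod N) :=
        fun i => (hX i).comp_fst
      have h2 : AEMeasurable (fun p : Ω × (Fin m → ℝ) => ∑ i, p.2 i * X i p.1) (P.prod N) :=
        Finset.aemeasurable_fun_sum _ fun i _ => AEMeasurable.mul (by fun_prop) (h1 i)
      exact AEMeasurable.aestronglyMeasurable (by
        change AEMeasurable (fun p : Ω × (Fin m → ℝ) => Complex.exp ((δ⁻¹ : ℝ) *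
          ((∑ i, p.2 i * X i p.1 : ℝ) : ℂ) * Complex.I)) (P.prod N)
        fun_prop)
    · change ‖Complex.exp _‖ ≤ 1
      rw [← Complex.ofReal_mul, Complex.norm_exp_ofReal_mul_I]
  have hgint : Integrable g P := by
    have := hint.integral_prod_left.re
    refine this.congr (ae_of_all _ fun ω => ?_)
    change (∫ ξ, Φ ω ξ ∂N).re = g ω
    rw [hg, Complex.ofReal_re]
  have hfub : ((∫ ω, g ω ∂P : ℝ) : ℂ)
      = ((∫ ξ, Real.exp (-Var[fun ω => ∑ i, ξ i * X i ω; P] * δ⁻¹ ^ 2 / 2) ∂N : ℝ) : ℂ) := by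
    rw [← integral_complex_ofReal, ← integral_complex_ofReal]
    simp_rw [← hg, ← fun ξ : Fin m → ℝ => (hG ξ).integral_exp δ⁻¹]
    exact integral_integral_swap hint
  have hfub' : ∫ ω, g ω ∂P
      = ∫ ξ, Real.exp (-Var[fun ω => ∑ i, ξ i * X i ω; P] * δ⁻¹ ^ 2 / 2) ∂N := by
    exact_mod_cast hfub
  have hle : ∫ ω, g ω ∂P ≤ (δ / Real.sqrt lam) ^ m := by
    rw [hfub']
    have hprod : ∀ ξ : Fin m → ℝ, Real.exp (-(lam * ∑ i, ξ i ^ 2) * δ⁻¹ ^ 2 / 2)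
        = ∏ i, Real.exp (-(lam / δ ^ 2) * ξ i ^ 2 / 2) := fun ξ => by
      rw [← Real.exp_sum]
      congr 1
      rw [← Finset.sum_div, ← Finset.mul_sum]
      field_simp
    have hint2 : Integrable (fun ξ : Fin m → ℝ =>
        Real.exp (-(lam * ∑ i, ξ i ^ 2) * δ⁻¹ ^ 2 / 2)) N := by
      refine (integrable_const (1 : ℝ)).mono'
        (by fun_prop : Continuous _).aestronglyMeasurable (ae_of_all _ fun ξ => ?_)
      rw [Real.norm_eq_abs, abs_of_pos (Real.exp_pos _)]
      apply Real.exp_le_one_iff.2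
      have : 0 ≤ lam * ∑ i, ξ i ^ 2 := by positivity
      have h2 : 0 ≤ lam * (∑ i, ξ i ^ 2) * δ⁻¹ ^ 2 := by positivity
      linarith
    calc ∫ ξ, Real.exp (-Var[fun ω => ∑ i, ξ i * X i ω; P] * δ⁻¹ ^ 2 / 2) ∂N
        ≤ ∫ ξ, Real.exp (-(lam * ∑ i, ξ i ^ 2) * δ⁻¹ ^ 2 / 2) ∂N := by
          refine integral_mono_of_nonneg (ae_of_all _ fun ξ => (Real.exp_pos _).le) hint2
            (ae_of_all _ fun ξ => ?_)
          apply Real.exp_le_exp.2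
          have := mul_le_mul_of_nonneg_right (hV ξ) (sq_nonneg δ⁻¹)
          linarith
      _ = ∏ _i : Fin m, ∫ x, Real.exp (-(lam / δ ^ 2) * x ^ 2 / 2) ∂(gaussianReal 0 1) := by
          simp_rw [hprod]
          exact integral_fintype_prod_eq_prod
            (f := fun _ (x : ℝ) => Real.exp (-(lam / δ ^ 2) * x ^ 2 / 2))
      _ ≤ ∏ _i : Fin m, δ / Real.sqrt lam := by
          refine Finset.prod_le_prod (fun i _ => integral_nonneg fun x => (Real.exp_pos _).le)
            fun i _ => (integral_exp_neg_mul_sq_gaussianReal_le (by positivity)).trans_eq ?_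
          rw [Real.sqrt_div hlam.le, Real.sqrt_sq hδ.le, inv_div]
      _ = _ := by rw [Finset.prod_const, Finset.card_univ, Fintype.card_fin]
  have hmarkov := mul_meas_ge_le_integral_of_nonneg
    (ae_of_all P fun ω => (Real.exp_pos _).le) hgint (Real.exp (-(m / 2)))
  have hsub : {ω | ∀ i, |X i ω| ≤ δ} ⊆ {ω | Real.exp (-(m / 2)) ≤ g ω} := by
    intro ω hω
    apply Real.exp_le_exp.2
    have h1 : ∑ i, X i ω ^ 2 ≤ ∑ _i : Fin m, δ ^ 2 := Finset.sum_le_sum fun i _ => by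
      rw [← sq_abs]; exact pow_le_pow_left₀ (abs_nonneg _) (hω i) 2
    rw [Finset.sum_const, Finset.card_univ, Fintype.card_fin, nsmul_eq_mul] at h1
    rw [neg_div, neg_le_neg_iff, div_le_iff₀ (by positivity)]
    linarith
  have hmono := measureReal_mono hsub (h₂ := measure_ne_top P _)
  calc P.real {ω | ∀ i, |X i ω| ≤ δ} ≤ P.real {ω | Real.exp (-(m / 2)) ≤ g ω} := hmono
    _ = Real.exp (m / 2) * (Real.exp (-(m / 2)) * P.real {ω | Real.exp (-(m / 2)) ≤ g ω}) := by
        rw [← mul_assoc, ← Real.exp_add]; simp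
    _ ≤ Real.exp (m / 2) * (δ / Real.sqrt lam) ^ m := by
        gcongr
        exact hmarkov.trans hle

end

/-! ### Jets of a stationary Gaussian field -/

section

lemma gradient_apply_eq_fderiv (u : Plane → ℝ) (x : Plane) (j : Fin 2) :
    gradient u x j = fderiv ℝ u x (EuclideanSpace.single j 1) := by
  rw [← toDual_gradient (𝕜 := ℝ), InnerProductSpace.toDual_apply_apply,
    EuclideanSpace.inner_single_right]
  simp only [one_mul, conj_trivial]

lemma contDiff_gradient_apply {u : Plane → ℝ} (hu : ContDiff ℝ 3 u) (j : Fin 2) :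
    ContDiff ℝ 2 fun x => gradient u x j := by
  simp_rw [gradient_apply_eq_fderiv]
  exact (hu.fderiv_right (by norm_num)).clm_apply contDiff_const

variable {Ω : Type*}

/-- The coordinates of the `1`-jet of a field at `x`: the value for `none`, the partial derivatives
for `some j`. -/
noncomputable def fieldJet (f : Plane → Ω → ℝ) (x : Plane) : Option (Fin 2) → Ω → ℝ
  | none => f x
  | some j => fun ω => fieldGradient f x ω j

/-- The offset, in direction `k`, of the difference quotient of step `1 / (n + 1)`; it vanishes for
the value coordinate `none` of the jet. -/
noncomputable def jetOffset (n : ℕ) : Option (Fin 2) → Plane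
  | none => 0
  | some j => ((n : ℝ) + 1)⁻¹ • EuclideanSpace.single j 1

/-- The difference quotients approximating the coordinates of the `1`-jet. -/
noncomputable def jetApprox (f : Plane → Ω → ℝ) (n : ℕ) (x : Plane) : Option (Fin 2) → Ω → ℝ
  | none => f x
  | some j => fun ω => ((n : ℝ) + 1) * (f (x + jetOffset n (some j)) ω - f x ω)

lemma contDiff_fieldJet {f : Plane → Ω → ℝ} {ω : Ω} (h : ContDiff ℝ 3 fun x => f x ω)
    (k : Option (Fin 2)) : ContDiff ℝ 2 fun x => fieldJet f x k ω := by
  cases k with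
  | none => exact h.of_le (by norm_num)
  | some j => exact contDiff_gradient_apply h j

lemma tendsto_jetApprox {f : Plane → Ω → ℝ} {ω : Ω} (h : ContDiff ℝ 3 fun x => f x ω)
    (x : Plane) (k : Option (Fin 2)) :
    Tendsto (fun n => jetApprox f n x k ω) atTop (𝓝 (fieldJet f x k ω)) := by
  cases k with
  | none => exact tendsto_const_nhds
  | some j =>
    have hd : HasFDerivAt (fun x => f x ω) (fderiv ℝ (fun x => f x ω) x) x :=
      (h.differentiable (by norm_num) x).hasFDerivAt
    have := hd.lim_real (EuclideanSpace.single j 1)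
    have h2 := this.comp (tendsto_atTop_add_const_right atTop (1 : ℝ)
      (tendsto_natCast_atTop_atTop (R := ℝ)))
    simp only [fieldJet, fieldGradient, gradient_apply_eq_fderiv]
    exact h2

variable [MeasurableSpace Ω] {P : Measure Ω} {f : Plane → Ω → ℝ}

namespace IsStationaryCentredGaussianField

lemma isCentredGaussian_sum (hf : IsStationaryCentredGaussianField f P) {J : Type*} [Fintype J]
    (c : J → ℝ) (x : J → Plane) : IsCentredGaussian (fun ω => ∑ j, c j * f (x j) ω) P := by
  refine ⟨((hf.gaussian.comp_right x).smul c).hasGaussianLaw_fun_sum (I := Finset.univ), ?_⟩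
  rw [integral_finsetSum]
  · simp [integral_const_mul, hf.centred]
  · exact fun j _ => ((hf.gaussian.hasGaussianLaw_eval (x j)).integrable).const_mul _

lemma isCentredGaussian_sum_jetApprox (hf : IsStationaryCentredGaussianField f P) {J : Type*}
    [Fintype J] (c : J → ℝ) (x : J → Plane) (k : J → Option (Fin 2)) (n : ℕ) :
    IsCentredGaussian (fun ω => ∑ j, c j * jetApprox f n (x j) (k j) ω) P := by
  let a : Option (Fin 2) → Bool → ℝ := fun k b =>
    match k with
    | none => if b then 1 else 0
    | some _ => if b then (n : ℝ) + 1 else -((n : ℝ) + 1)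
  have h := hf.isCentredGaussian_sum (J := J × Bool) (fun p => c p.1 * a (k p.1) p.2)
    (fun p => x p.1 + if p.2 then jetOffset n (k p.1) else 0)
  refine h.congr (ae_of_all _ fun ω => ?_)
  simp only [Fintype.sum_prod_type, Fintype.sum_bool]
  refine Finset.sum_congr rfl fun j _ => ?_
  rcases hk : k j with _ | i
  · simp [a, jetApprox, jetOffset]
  · simp [a, jetApprox]
    ring

lemma isCentredGaussian_sum_fieldJet [IsProbabilityMeasure P]
    (hf : IsStationaryCentredGaussianField f P) (hs : ∀ᵐ ω ∂P, ContDiff ℝ 3 fun x => f x ω)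
    {J : Type*} [Fintype J] (c : J → ℝ) (x : J → Plane) (k : J → Option (Fin 2)) :
    IsCentredGaussian (fun ω => ∑ j, c j * fieldJet f (x j) (k j) ω) P := by
  refine (IsCentredGaussian.of_tendsto
    (fun n => hf.isCentredGaussian_sum_jetApprox c x k n) ?_).1
  filter_upwards [hs] with ω hω
  exact tendsto_finsetSum _ fun j _ => (tendsto_jetApprox hω (x j) (k j)).const_mul _

lemma isCentredGaussian_fieldJet [IsProbabilityMeasure P]
    (hf : IsStationaryCentredGaussianField f P) (hs : ∀ᵐ ω ∂P, ContDiff ℝ 3 fun x => f x ω)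
    (x : Plane) (k : Option (Fin 2)) : IsCentredGaussian (fieldJet f x k) P := by
  simpa using hf.isCentredGaussian_sum_fieldJet hs (J := Unit) (fun _ => 1) (fun _ => x)
    (fun _ => k)

/-- The variance of a linear combination of jet coordinates depends continuously on the
coefficients and the points. -/
lemma continuous_variance_sum_fieldJet [IsProbabilityMeasure P]
    (hf : IsStationaryCentredGaussianField f P) (hs : ∀ᵐ ω ∂P, ContDiff ℝ 3 fun x => f x ω)
    {J : Type*} [Fintype J] {Z : Type*} [TopologicalSpace Z] [FirstCountableTopology Z]
    {c : Z → J → ℝ} {x : Z → J → Plane} (hc : Continuous c) (hx : Continuous x)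
    (k : J → Option (Fin 2)) :
    Continuous fun z => Var[fun ω => ∑ j, c z j * fieldJet f (x z j) (k j) ω; P] := by
  refine continuous_iff_seqContinuous.2 fun z z₀ hz => ?_
  refine (IsCentredGaussian.of_tendsto
    (fun n => hf.isCentredGaussian_sum_fieldJet hs (c (z n)) (x (z n)) k) ?_).2
  filter_upwards [hs] with ω hω
  refine tendsto_finsetSum _ fun j _ => ?_
  have hcont : Continuous fun z => c z j * fieldJet f (x z j) (k j) ω :=
    ((continuous_apply j).comp hc).mul
      ((contDiff_fieldJet hω (k j)).continuous.comp ((continuous_apply j).comp hx))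
  exact (hcont.tendsto z₀).comp hz

/-- The jets of the field along a countable family of points have a translation invariant law. -/
theorem identDistrib_fieldJet [IsProbabilityMeasure P]
    (hf : IsStationaryCentredGaussianField f P) (hs : ∀ᵐ ω ∂P, ContDiff ℝ 3 fun x => f x ω)
    {J : Type*} [Countable J] (x : J → Plane) (z : Plane) :
    IdentDistrib (fun ω j k => fieldJet f (x j + z) k ω) (fun ω j k => fieldJet f (x j) k ω)
      P P := by
  -- the values of the field at the points used by the difference quotients
  let pt : J × Option (Fin 2 × ℕ) → Plane := fun t =>
    match t with
    | (j, none) => x j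
    | (j, some (i, n)) => x j + jetOffset n (some i)
  have hm : ∀ y, AEMeasurable (f y) P := hf.gaussian.aemeasurable
  have hid : IdentDistrib (fun ω t => f (pt t + z) ω) (fun ω t => f (pt t) ω) P P := by
    rw [identDistrib_iff_forall_finset_identDistrib (X := fun t ω => f (pt t + z) ω)
      (Y := fun t ω => f (pt t) ω) (aemeasurable_pi_lambda _ fun _ => hm _)
      (aemeasurable_pi_lambda _ fun _ => hm _)]
    intro I
    classical
    have h := hf.stationary z (I.image pt)
    have h0 : IdentDistrib (fun ω (y : I.image pt) => f ((y : Plane) + z) ω)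
        (fun ω (y : I.image pt) => f (y : Plane) ω) P P :=
      ⟨aemeasurable_pi_lambda _ fun _ => hm _, aemeasurable_pi_lambda _ fun _ => hm _, h⟩
    let Ψ : (I.image pt → ℝ) → (I → ℝ) := fun g t =>
      g ⟨pt t, Finset.mem_image_of_mem pt t.2⟩
    have hΨ : Measurable Ψ := measurable_pi_lambda _ fun t => measurable_pi_apply _
    exact h0.comp hΨ
  let Φ : (J × Option (Fin 2 × ℕ) → ℝ) → J → Option (Fin 2) → ℝ := fun y j k =>
    match k with
    | none => y (j, none)
    | some i => limsup (fun n : ℕ => ((n : ℝ) + 1) * (y (j, some (i, n)) - y (j, none))) atTop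
  have hΦ : Measurable Φ := by
    refine measurable_pi_lambda _ fun j => measurable_pi_lambda _ fun k => ?_
    cases k with
    | none => exact measurable_pi_apply _
    | some i =>
      exact Measurable.limsup fun n => measurable_const.mul
        ((measurable_pi_apply _).sub (measurable_pi_apply _))
  have key : ∀ w, (fun ω => Φ (fun t => f (pt t + w) ω))
      =ᵐ[P] fun ω j k => fieldJet f (x j + w) k ω := by
    intro w
    filter_upwards [hs] with ω hω
    ext j k
    have ht := tendsto_jetApprox hω (x j + w) k
    cases k with
    | none => rfl
    | some i =>
      refine Eq.trans ?_ ht.limsup_eq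
      simp only [Φ, pt, jetApprox]
      congr 1
      ext n
      rw [add_right_comm]
  have h1 := hid.comp hΦ
  have e1 := key z
  have e0 := key 0
  simp only [add_zero] at e0
  refine ⟨h1.aemeasurable_fst.congr e1, h1.aemeasurable_snd.congr e0, ?_⟩
  rw [← Measure.map_congr e1, ← Measure.map_congr e0]
  exact h1.map_eq

lemma variance_sum_fieldJet_add [IsProbabilityMeasure P]
    (hf : IsStationaryCentredGaussianField f P) (hs : ∀ᵐ ω ∂P, ContDiff ℝ 3 fun x => f x ω)
    {J : Type*} [Fintype J] (c : J → ℝ) (x : J → Plane) (k : J → Option (Fin 2)) (z : Plane) :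
    Var[fun ω => ∑ j, c j * fieldJet f (x j + z) (k j) ω; P]
      = Var[fun ω => ∑ j, c j * fieldJet f (x j) (k j) ω; P] := by
  have h := (hf.identDistrib_fieldJet hs x z).comp
    (u := fun y : J → Option (Fin 2) → ℝ => ∑ j, c j * y j (k j)) (by fun_prop)
  exact h.variance_eq

/-- The derivatives of the field are Lipschitz in mean square, since second derivatives of the
realisations exist and are Gaussian. -/
theorem exists_variance_fieldJet_sub_le [IsProbabilityMeasure P]
    (hf : IsStationaryCentredGaussianField f P) (hs : ∀ᵐ ω ∂P, ContDiff ℝ 3 fun x => f x ω)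
    (k : Option (Fin 2)) :
    ∃ C : ℝ, 0 ≤ C ∧ ∀ x y : Plane,
      Var[fun ω => fieldJet f x k ω - fieldJet f y k ω; P] ≤ C * ‖x - y‖ ^ 2 := by
  let V : Plane → ℝ := fun h => Var[fun ω => fieldJet f h k ω - fieldJet f 0 k ω; P]
  have hG : ∀ x y, IsCentredGaussian (fun ω => fieldJet f x k ω - fieldJet f y k ω) P := by
    intro x y
    have := hf.isCentredGaussian_sum_fieldJet hs (J := Fin 2) ![1, -1] ![x, y] (fun _ => k)
    simpa [Fin.sum_univ_two, sub_eq_add_neg] using this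
  have hshift : ∀ x y, Var[fun ω => fieldJet f x k ω - fieldJet f y k ω; P] = V (x - y) := by
    intro x y
    have := hf.variance_sum_fieldJet_add hs (J := Fin 2) ![1, -1] ![x - y, 0] (fun _ => k) y
    simpa [Fin.sum_univ_two, ← sub_eq_add_neg, V] using this
  by_contra! hcon
  have hex : ∀ n : ℕ, ∃ h : Plane, (n : ℝ) * ‖h‖ ^ 2 < V h := by
    intro n
    obtain ⟨x, y, hxy⟩ := hcon n (Nat.cast_nonneg n)
    exact ⟨x - y, by rwa [hshift] at hxy⟩
  choose h hh using hex
  have hmem : ∀ x, MemLp (fieldJet f x k) 2 P := fun x =>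
    (hf.isCentredGaussian_fieldJet hs x k).hasGaussianLaw.memLp_two
  have hh0 : ∀ n, h n ≠ 0 := by
    intro n h0
    have := hh n
    rw [h0] at this
    simp only [V, sub_self] at this
    rw [norm_zero, zero_pow two_ne_zero, mul_zero] at this
    exact this.ne' (variance_zero P)
  have hVle : ∀ n, V (h n) ≤ 4 * Var[fieldJet f 0 k; P] := by
    intro n
    have e1 : Var[fieldJet f (h n) k; P] = Var[fieldJet f 0 k; P] := by
      have := hf.variance_sum_fieldJet_add hs (J := Unit) (fun _ => 1) (fun _ => 0)
        (fun _ => k) (h n)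
      simpa using this
    have e2 := variance_fun_sub (hmem (h n)) (hmem 0)
    have e3 := variance_fun_add (hmem (h n)) (hmem 0)
    have e4 := variance_nonneg (fun ω => fieldJet f (h n) k ω + fieldJet f 0 k ω) P
    simp only [V]
    linarith
  have hlim : Tendsto h atTop (𝓝 0) := by
    rw [tendsto_zero_iff_norm_tendsto_zero]
    have h1 : ∀ᶠ n : ℕ in atTop, ‖h n‖ ≤ Real.sqrt (4 * Var[fieldJet f 0 k; P] / n) := by
      filter_upwards [eventually_gt_atTop 0] with n hn
      apply Real.le_sqrt_of_sq_le
      rw [le_div_iff₀ (by exact_mod_cast hn), mul_comm]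
      exact (hh n).le.trans (hVle n)
    have h2 : Tendsto (fun n : ℕ => Real.sqrt (4 * Var[fieldJet f 0 k; P] / n)) atTop (𝓝 0) := by
      have := (tendsto_const_div_atTop_nhds_zero_nat (4 * Var[fieldJet f 0 k; P])).sqrt
      rwa [Real.sqrt_zero] at this
    exact squeeze_zero' (Eventually.of_forall fun n => norm_nonneg _) h1 h2
  have hnorm : ∀ n, 0 < ‖h n‖ := fun n => norm_pos_iff.2 (hh0 n)
  -- along a subsequence the directions converge
  obtain ⟨e, -, φ, hφ, he⟩ := (isCompact_sphere (0 : Plane) 1).tendsto_subseq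
    (x := fun n => ‖h n‖⁻¹ • h n) fun n => by
      simp [norm_smul, (hnorm n).ne']
  have hconv := (IsCentredGaussian.of_tendsto (P := P)
    (X := fun ω => fderiv ℝ (fun x => fieldJet f x k ω) 0 e)
    (Xs := fun n ω => ‖h (φ n)‖⁻¹ * (fieldJet f (h (φ n)) k ω - fieldJet f 0 k ω))
    (fun n => (hG _ _).const_mul _) (by
      filter_upwards [hs] with ω hω
      have hd : HasFDerivAt (fun x => fieldJet f x k ω)
          (fderiv ℝ (fun x => fieldJet f x k ω) 0) 0 :=
        ((contDiff_fieldJet hω k).differentiable (by norm_num) 0).hasFDerivAt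
      have := hd.hasFDerivWithinAt (s := Set.univ) |>.lim (l := atTop)
        (c := fun n => ‖h (φ n)‖⁻¹) (d := fun n => h (φ n)) (v := e)
        (hlim.comp hφ.tendsto_atTop) (Eventually.of_forall fun n => Set.mem_univ _) he
      simpa using this)).2
  obtain ⟨B, hB⟩ := hconv.bddAbove_range
  obtain ⟨n, hn⟩ := exists_nat_gt B
  have h1 := hB ⟨n, rfl⟩
  simp only [variance_const_mul] at h1
  have h2 := hh (φ n)
  have h3 : (φ n : ℝ) < ‖h (φ n)‖⁻¹ ^ 2 * V (h (φ n)) := by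
    rw [inv_pow, inv_mul_eq_div, lt_div_iff₀ (pow_pos (hnorm _) 2)]
    exact h2
  have h4 : (n : ℝ) ≤ φ n := by exact_mod_cast hφ.id_le n
  simp only [V] at h3
  linarith

end IsStationaryCentredGaussianField

end

/-! ### Uniform non-degeneracy of the jets -/

section

variable {Ω : Type*} {f : Plane → Ω → ℝ}

/-- The coordinates of the jets that enter `valueGradientVector`, in the same order. -/
def jetIndex : Fin 6 → Option (Fin 2) := ![none, none, some 0, some 1, some 0, some 1]

/-- The point at which each of the six jet coordinates is taken. -/
def jetPoint (a b : Plane) : Fin 6 → Plane := ![a, b, a, a, b, b]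

lemma valueGradientVector_eq_fieldJet (x : Plane) (i : Fin 6) :
    valueGradientVector f x i = fieldJet f (jetPoint 0 x i) (jetIndex i) := by
  fin_cases i <;> rfl

variable [MeasurableSpace Ω] {P : Measure Ω} [IsProbabilityMeasure P]

/-- Linear combinations of the jets at two distinct points are non-degenerate. -/
theorem variance_sum_jetPoint_pos (hf : IsStationaryCentredGaussianField f P)
    (hA : SmoothNondegenerateDecaying f P) {a b : Plane} (hab : a ≠ b) {w : Fin 6 → ℝ}
    (hw : w ≠ 0) :
    0 < Var[fun ω => ∑ i, w i * fieldJet f (jetPoint a b i) (jetIndex i) ω; P] := by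
  have hpt : ∀ i, jetPoint a b i = jetPoint 0 (b - a) i + a := by
    intro i
    fin_cases i <;> simp [jetPoint]
  simp_rw [hpt]
  rw [hf.variance_sum_fieldJet_add hA.smooth w (jetPoint 0 (b - a)) jetIndex a]
  have hpos := (hA.nondegenerate (b - a) (sub_ne_zero.2 hab.symm)).dotProduct_mulVec_pos hw
  have hmem : ∀ i, MemLp (valueGradientVector f (b - a) i) 2 P := fun i => by
    rw [valueGradientVector_eq_fieldJet]
    exact (hf.isCentredGaussian_fieldJet hA.smooth _ _).hasGaussianLaw.memLp_two
  simp_rw [← valueGradientVector_eq_fieldJet]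
  rw [variance_fun_sum fun i => (hmem i).const_mul (w i)]
  refine lt_of_lt_of_eq hpos ?_
  simp only [dotProduct, Matrix.mulVec, Matrix.of_apply, Finset.mul_sum, star_trivial]
  refine Finset.sum_congr rfl fun i _ => Finset.sum_congr rfl fun j _ => ?_
  rw [covariance_const_mul_left, covariance_const_mul_right]
  ring

/-- Directional derivatives are uniformly non-degenerate. -/
theorem exists_le_variance_directional (hf : IsStationaryCentredGaussianField f P)
    (hA : SmoothNondegenerateDecaying f P) :
    ∃ lam : ℝ, 0 < lam ∧ ∀ (x : Plane) (c : Fin 2 → ℝ), c 0 ^ 2 + c 1 ^ 2 = 1 →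
      lam ≤ Var[fun ω => ∑ j, c j * fieldJet f x (some j) ω; P] := by
  let V : (Fin 2 → ℝ) → ℝ := fun c => Var[fun ω => ∑ j, c j * fieldJet f 0 (some j) ω; P]
  have hV : Continuous V := hf.continuous_variance_sum_fieldJet hA.smooth
    (c := fun c => c) (x := fun _ _ => 0) continuous_id continuous_const some
  let K : Set (Fin 2 → ℝ) := {c | c 0 ^ 2 + c 1 ^ 2 = 1}
  have hK : IsCompact K := by
    refine Metric.isCompact_of_isClosed_isBounded
      (isClosed_eq (by fun_prop) continuous_const) ?_
    refine (Metric.isBounded_closedBall (x := (0 : Fin 2 → ℝ)) (r := 1)).subset fun c hc => ?_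
    rw [mem_closedBall_zero_iff, pi_norm_le_iff_of_nonneg zero_le_one]
    have hc' : c 0 ^ 2 + c 1 ^ 2 = 1 := hc
    intro i
    rw [Real.norm_eq_abs, ← sq_le_one_iff_abs_le_one]
    fin_cases i
    · simp only [Fin.zero_eta]; nlinarith [sq_nonneg (c 1)]
    · simp only [Fin.mk_one]; nlinarith [sq_nonneg (c 0)]
  have hKne : K.Nonempty := ⟨![1, 0], by simp [K]⟩
  obtain ⟨c₀, hc₀, hmin⟩ := hK.exists_isMinOn hKne hV.continuousOn
  refine ⟨V c₀, ?_, fun x c hc => ?_⟩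
  · obtain ⟨b, hb⟩ := exists_ne (0 : Plane)
    have hw : (![0, 0, c₀ 0, c₀ 1, 0, 0] : Fin 6 → ℝ) ≠ 0 := by
      intro h0
      have h2 := congrFun h0 2
      have h3 := congrFun h0 3
      simp only [Matrix.cons_val, Pi.zero_apply] at h2 h3
      have hc' : c₀ 0 ^ 2 + c₀ 1 ^ 2 = 1 := hc₀
      rw [h2, h3] at hc'
      norm_num at hc'
    have := variance_sum_jetPoint_pos hf hA hb.symm hw
    simpa [Fin.sum_univ_succ, jetPoint, jetIndex, V] using this
  · have := hf.variance_sum_fieldJet_add hA.smooth c (fun _ => 0) some x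
    simp only [zero_add] at this
    rw [this]
    exact hmin hc

end

/-! ### Small values and sign changes of Gaussian variables -/

section

variable {Ω : Type*} [MeasurableSpace Ω] {P : Measure Ω}

lemma IsCentredGaussian.measure_abs_le_le [IsProbabilityMeasure P] {X : Ω → ℝ}
    (hX : IsCentredGaussian X P) {lam δ : ℝ} (hlam : 0 < lam) (hδ : 0 ≤ δ) (hV : lam ≤ Var[X; P]) :
    P.real {ω | |X ω| ≤ δ} ≤ Real.exp (1 / 2) * (δ / Real.sqrt lam) := by
  have hpos : ∀ η : ℝ, 0 < η → P.real {ω | |X ω| ≤ η} ≤ Real.exp (1 / 2) * (η / Real.sqrt lam) := by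
    intro η hη
    have := measure_forall_abs_le_le (P := P) (m := 1) (X := fun _ => X) hlam hη
      (fun _ => hX.aemeasurable) (fun ξ => by simpa using hX.const_mul (ξ 0)) (fun ξ => by
        simp only [Fin.sum_univ_one, Fin.isValue, variance_const_mul]
        rw [mul_comm]
        exact mul_le_mul_of_nonneg_left hV (sq_nonneg _))
    simpa using this
  have ht : Tendsto (fun η => Real.exp (1 / 2) * (η / Real.sqrt lam)) (𝓝[>] δ)
      (𝓝 (Real.exp (1 / 2) * (δ / Real.sqrt lam))) := by
    have hc : Continuous fun η => Real.exp (1 / 2) * (η / Real.sqrt lam) := by fun_prop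
    exact (hc.tendsto δ).mono_left nhdsWithin_le_nhds
  refine ge_of_tendsto ht ?_
  filter_upwards [self_mem_nhdsWithin] with η hη
  have hη' : δ < η := hη
  exact (measureReal_mono fun ω hω => le_trans hω hη'.le).trans (hpos η (hδ.trans_lt hη'))

lemma hasGaussianLaw_prodMk_of_forall {X Y : Ω → ℝ}
    (hG : ∀ a b : ℝ, IsCentredGaussian (fun ω => a * X ω + b * Y ω) P) :
    HasGaussianLaw (fun ω => (X ω, Y ω)) P := by
  have hX : AEMeasurable X P := by simpa using (hG 1 0).aemeasurable
  have hY : AEMeasurable Y P := by simpa using (hG 0 1).aemeasurable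
  refine ⟨isGaussian_of_isGaussian_map fun L => ?_⟩
  have h := (hG (L (1, 0)) (L (0, 1))).hasGaussianLaw.isGaussian_map
  rw [AEMeasurable.map_map_of_aemeasurable (by fun_prop) (hX.prodMk hY)]
  convert h using 2
  ext ω
  have : (X ω, Y ω) = X ω • ((1 : ℝ), (0 : ℝ)) + Y ω • ((0 : ℝ), (1 : ℝ)) := by simp
  simp only [Function.comp]
  rw [this, map_add, map_smul, map_smul, smul_eq_mul, smul_eq_mul, mul_comm, mul_comm (Y ω)]

/-- Two highly correlated centred Gaussian variables have opposite signs with a probability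
controlled by the standard deviation of their difference.

Opposite signs force `|X| ≤ |X - Y|`; replacing `X - Y` by its component independent of `X`, the
small ball estimate for `X` applies conditionally. -/
theorem measure_mul_neg_le [IsProbabilityMeasure P] {X Y : Ω → ℝ} {lam ε : ℝ}
    (hlam : 0 < lam) (hε : 0 < ε)
    (hG : ∀ a b : ℝ, IsCentredGaussian (fun ω => a * X ω + b * Y ω) P)
    (hV : lam ≤ Var[X; P]) (hD : Var[fun ω => X ω - Y ω; P] ≤ ε ^ 2) :
    P {ω | X ω * Y ω < 0} ≤ ENNReal.ofReal (4 * ε / Real.sqrt lam) := by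
  have hsl : 0 < Real.sqrt lam := Real.sqrt_pos.2 hlam
  by_cases hbig : Real.sqrt lam < 2 * ε
  · refine prob_le_one.trans ?_
    rw [ENNReal.one_le_ofReal, le_div_iff₀ hsl]
    linarith
  rw [not_lt] at hbig
  have hX : IsCentredGaussian X P := by simpa using hG 1 0
  have hXm := hX.hasGaussianLaw.memLp_two
  have hDG : IsCentredGaussian (fun ω => X ω - Y ω) P := by
    simpa [sub_eq_add_neg] using hG 1 (-1)
  have hDm := hDG.hasGaussianLaw.memLp_two
  have hVpos : 0 < Var[X; P] := hlam.trans_le hV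
  -- the regression coefficient of `X - Y` on `X`
  let α : ℝ := cov[fun ω => X ω - Y ω, X; P] / Var[X; P]
  let E : Ω → ℝ := fun ω => (X ω - Y ω) - α * X ω
  have hEG : IsCentredGaussian E P := by
    refine (hG (1 - α) (-1)).congr (ae_of_all _ fun ω => ?_)
    simp only [E]; ring
  have hVE : Var[E; P] = Var[fun ω => X ω - Y ω; P] - α ^ 2 * Var[X; P] := by
    simp only [E]
    rw [variance_fun_sub hDm (hXm.const_mul α), variance_const_mul, covariance_const_mul_right]
    have : cov[fun ω => X ω - Y ω, X; P] = α * Var[X; P] := by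
      simp only [α]; rw [div_mul_cancel₀ _ hVpos.ne']
    rw [this]
    ring
  have hVE1 : Var[E; P] ≤ ε ^ 2 := by
    rw [hVE]; nlinarith [sq_nonneg α]
  have hα : |α| ≤ 1 / 2 := by
    have h0 := variance_nonneg E P
    have h1 : α ^ 2 * lam ≤ ε ^ 2 := by nlinarith [sq_nonneg α]
    have h2 : (2 * ε) ^ 2 ≤ lam := by
      rw [← Real.sq_sqrt hlam.le]; exact pow_le_pow_left₀ (by positivity) hbig 2
    have h3 : α ^ 2 ≤ (1 / 2) ^ 2 := by
      by_contra! hcon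
      nlinarith
    exact abs_le_of_sq_le_sq h3 (by norm_num)
  have hind : IndepFun X E P := by
    refine HasGaussianLaw.indepFun_of_covariance_eq_zero (hasGaussianLaw_prodMk_of_forall
      fun a b => ?_) ?_
    · refine (hG (a + b * (1 - α)) (-b)).congr (ae_of_all _ fun ω => ?_)
      simp only [E]; ring
    · rw [covariance_comm]
      simp only [E]
      rw [covariance_fun_sub_left hDm (hXm.const_mul α) hXm, covariance_const_mul_left,
        covariance_self hX.aemeasurable]
      simp only [α]
      rw [div_mul_cancel₀ _ hVpos.ne', sub_self]
  have hsub : {ω | X ω * Y ω < 0} ⊆ {ω | |X ω| ≤ 2 * |E ω|} := by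
    intro ω hω
    have hω' : X ω * Y ω < 0 := hω
    change |X ω| ≤ 2 * |E ω|
    have h1 : |X ω| ≤ |X ω - Y ω| := by
      rw [← sq_le_sq]; nlinarith [sq_nonneg (Y ω)]
    have h2 : |X ω - Y ω| ≤ |E ω| + |α * X ω| := by
      have : X ω - Y ω = E ω + α * X ω := by simp only [E]; ring
      rw [this]; exact abs_add_le _ _
    rw [abs_mul] at h2
    nlinarith [abs_nonneg (X ω)]
  have hmap := (indepFun_iff_map_prod_eq_prod_map_map hX.aemeasurable hEG.aemeasurable).1 hind
  have hS : MeasurableSet {p : ℝ × ℝ | |p.1| ≤ 2 * |p.2|} :=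
    measurableSet_le (by fun_prop) (by fun_prop)
  have hprobX : IsProbabilityMeasure (P.map X) := Measure.isProbabilityMeasure_map hX.aemeasurable
  have hprobE : IsProbabilityMeasure (P.map E) := Measure.isProbabilityMeasure_map hEG.aemeasurable
  have hcond : ∀ e : ℝ, (P.map X) ((fun x => (x, e)) ⁻¹' {p : ℝ × ℝ | |p.1| ≤ 2 * |p.2|})
      ≤ ENNReal.ofReal (4 / Real.sqrt lam * |e|) := by
    intro e
    rw [Measure.map_apply_of_aemeasurable hX.aemeasurable (hS.preimage (by fun_prop))]
    have h1 := hX.measure_abs_le_le hlam (δ := 2 * |e|) (by positivity) hV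
    rw [← ENNReal.ofReal_toReal (measure_ne_top P _)]
    apply ENNReal.ofReal_le_ofReal
    refine h1.trans ?_
    have h2 : Real.exp (1 / 2) ≤ 2 := by
      have h3 : Real.exp (1 / 2) ^ 2 ≤ 2 ^ 2 := by
        rw [← Real.exp_nat_mul]
        have := Real.exp_one_lt_d9
        norm_num
        linarith
      exact le_of_sq_le_sq h3 (by norm_num)
    have h4 : 0 ≤ 2 * |e| / Real.sqrt lam := by positivity
    calc Real.exp (1 / 2) * (2 * |e| / Real.sqrt lam) ≤ 2 * (2 * |e| / Real.sqrt lam) := by gcongr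
      _ = _ := by ring
  have hEint : Integrable (fun ω => |E ω|) P := hEG.hasGaussianLaw.integrable.abs
  have hE1 : ∫ ω, |E ω| ∂P ≤ ε := by
    have hsq : Integrable (fun ω => E ω ^ 2) P := hEG.hasGaussianLaw.memLp_two.integrable_sq
    have h1 : ∫ ω, |E ω| ∂P ≤ ∫ ω, (E ω ^ 2 * (2 * ε)⁻¹ + ε / 2) ∂P := by
      refine integral_mono hEint ((hsq.mul_const _).add (integrable_const _)) fun ω => ?_
      have : 0 ≤ (|E ω| - ε) ^ 2 * (2 * ε)⁻¹ := by positivity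
      have h2 : (|E ω| - ε) ^ 2 * (2 * ε)⁻¹ = E ω ^ 2 * (2 * ε)⁻¹ + ε / 2 - |E ω| := by
        rw [sub_sq, sq_abs]; field_simp; ring
      simp only
      linarith
    rw [integral_add (hsq.mul_const _) (integrable_const _), integral_mul_const,
      ← variance_of_integral_eq_zero hEG.aemeasurable hEG.integral_eq_zero, integral_const] at h1
    have h2 : Var[E; P] * (2 * ε)⁻¹ ≤ ε ^ 2 * (2 * ε)⁻¹ := by gcongr
    have h3 : ε ^ 2 * (2 * ε)⁻¹ = ε / 2 := by field_simp
    simp only [probReal_univ, one_smul] at h1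
    linarith
  calc P {ω | X ω * Y ω < 0} ≤ P {ω | |X ω| ≤ 2 * |E ω|} := measure_mono hsub
    _ = (P.map fun ω => (X ω, E ω)) {p : ℝ × ℝ | |p.1| ≤ 2 * |p.2|} := by
        rw [Measure.map_apply_of_aemeasurable (hX.aemeasurable.prodMk hEG.aemeasurable) hS]
        rfl
    _ = ∫⁻ e, (P.map X) ((fun x => (x, e)) ⁻¹' {p : ℝ × ℝ | |p.1| ≤ 2 * |p.2|}) ∂(P.map E) := by
        rw [hmap, Measure.prod_apply_symm hS]
    _ ≤ ∫⁻ e, ENNReal.ofReal (4 / Real.sqrt lam * |e|) ∂(P.map E) := lintegral_mono hcond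
    _ = ∫⁻ ω, ENNReal.ofReal (4 / Real.sqrt lam * |E ω|) ∂P :=
        lintegral_map' (by fun_prop) hEG.aemeasurable
    _ = ENNReal.ofReal (∫ ω, 4 / Real.sqrt lam * |E ω| ∂P) :=
        (ofReal_integral_eq_lintegral_ofReal (hEint.const_mul _)
          (ae_of_all _ fun ω => by positivity)).symm
    _ ≤ ENNReal.ofReal (4 * ε / Real.sqrt lam) := by
        apply ENNReal.ofReal_le_ofReal
        rw [integral_const_mul]
        calc 4 / Real.sqrt lam * ∫ ω, |E ω| ∂P ≤ 4 / Real.sqrt lam * ε := by gcongr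
          _ = _ := by ring

end

/-! ### Distinct levels of critical points -/

section

/-- The closed square of side `2` centred at `z`. -/
def unitSquare (z : Plane) : Set Plane := {x | ∀ j, |x j - z j| ≤ 1}

/-- The points of the `n × n` mesh of the square centred at `z`. -/
noncomputable def meshPoint (z : Plane) (n : ℕ) (p : Fin n × Fin n) : Plane :=
  z + !₂[-1 + 2 * (p.1 : ℝ) / n, -1 + 2 * (p.2 : ℝ) / n]

lemma norm_le_abs_add_abs (x : Plane) : ‖x‖ ≤ |x 0| + |x 1| := by
  rw [EuclideanSpace.norm_eq, Fin.sum_univ_two, Real.norm_eq_abs, Real.norm_eq_abs]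
  apply Real.sqrt_le_iff.2
  refine ⟨by positivity, ?_⟩
  nlinarith [abs_nonneg (x 0), abs_nonneg (x 1)]

lemma isCompact_unitSquare (z : Plane) : IsCompact (unitSquare z) := by
  refine Metric.isCompact_of_isClosed_isBounded ?_ ?_
  · simp only [unitSquare, Set.ofPred_forall]
    exact isClosed_iInter fun j => isClosed_le (by fun_prop) continuous_const
  · refine (Metric.isBounded_closedBall (x := z) (r := 2)).subset fun x hx => ?_
    rw [mem_closedBall_iff_norm]
    refine (norm_le_abs_add_abs _).trans ?_
    have h0 := hx 0
    have h1 := hx 1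
    simp only [PiLp.sub_apply]
    linarith

lemma exists_index_abs_sub_le {n : ℕ} (hn : 0 < n) {t : ℝ} (ht : |t| ≤ 1) :
    ∃ i : Fin n, |t - (-1 + 2 * (i : ℝ) / n)| ≤ 2 / n := by
  have hn' : (0 : ℝ) < n := by exact_mod_cast hn
  obtain ⟨h1, h2⟩ := abs_le.1 ht
  by_cases hlt : t = 1
  · refine ⟨⟨n - 1, by omega⟩, ?_⟩
    simp only [Nat.cast_sub (show 1 ≤ n from hn), Nat.cast_one, hlt]
    rw [abs_le]
    constructor <;> field_simp <;> linarith
  have ht1 : t < 1 := lt_of_le_of_ne h2 hlt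
  have hnn : 0 ≤ (t + 1) * n / 2 := by
    have : 0 ≤ t + 1 := by linarith
    positivity
  have hfl := Nat.floor_le hnn
  have hlf := Nat.lt_floor_add_one ((t + 1) * n / 2)
  have hfn : ⌊(t + 1) * n / 2⌋₊ < n := by
    rw [Nat.floor_lt hnn]
    nlinarith
  generalize ⌊(t + 1) * n / 2⌋₊ = k at hfl hlf hfn
  refine ⟨⟨k, hfn⟩, ?_⟩
  · simp only
    rw [abs_le]
    constructor
    · rw [← sub_nonneg]; field_simp; linarith
    · rw [← sub_nonneg]; field_simp; linarith

lemma exists_meshPoint {z x : Plane} (hx : x ∈ unitSquare z) {n : ℕ} (hn : 0 < n) :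
    ∃ p, ‖x - meshPoint z n p‖ ≤ 4 / n := by
  obtain ⟨i, hi⟩ := exists_index_abs_sub_le hn (hx 0)
  obtain ⟨j, hj⟩ := exists_index_abs_sub_le hn (hx 1)
  refine ⟨(i, j), (norm_le_abs_add_abs _).trans ?_⟩
  have e0 : (x - meshPoint z n (i, j)) 0 = x 0 - z 0 - (-1 + 2 * (i : ℝ) / n) := by
    simp [meshPoint]; ring
  have e1 : (x - meshPoint z n (i, j)) 1 = x 1 - z 1 - (-1 + 2 * (j : ℝ) / n) := by
    simp [meshPoint]; ring
  rw [e0, e1]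
  calc _ ≤ 2 / (n : ℝ) + 2 / n := add_le_add hi hj
    _ = 4 / n := by ring

lemma meshPoint_mem (z : Plane) (n : ℕ) (p : Fin n × Fin n) : meshPoint z n p ∈ unitSquare z := by
  have key : ∀ i : Fin n, |(-1 + 2 * (i : ℝ) / n : ℝ)| ≤ 1 := by
    intro i
    have h1 : (i : ℝ) ≤ n := by exact_mod_cast i.2.le
    have hn : (0 : ℝ) < n := by exact_mod_cast (Nat.zero_le _).trans_lt i.2
    have h2 : 2 * (i : ℝ) / n ≤ 2 := by rw [div_le_iff₀ hn]; linarith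
    have h3 : 0 ≤ 2 * (i : ℝ) / n := by positivity
    rw [abs_le]; constructor <;> linarith
  intro j
  fin_cases j
  · simpa [meshPoint] using key p.1
  · simpa [meshPoint] using key p.2

/-- The coefficients, in terms of the jets at two points `a` and `b`, of a linear combination of
`f a - f b`, `∇f a` and `∇f b`. -/
def differenceCoeff (ξ : Fin 5 → ℝ) : Fin 6 → ℝ := ![ξ 0, -ξ 0, ξ 1, ξ 2, ξ 3, ξ 4]

lemma differenceCoeff_ne_zero {ξ : Fin 5 → ℝ} (hξ : ξ ≠ 0) : differenceCoeff ξ ≠ 0 := by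
  contrapose! hξ
  ext i
  have h0 := congrFun hξ 0
  have h2 := congrFun hξ 2
  have h3 := congrFun hξ 3
  have h4 := congrFun hξ 4
  have h5 := congrFun hξ 5
  simp only [differenceCoeff, Matrix.cons_val, Pi.zero_apply] at h0 h2 h3 h4 h5
  fin_cases i <;> assumption

variable {Ω : Type*} {f : Plane → Ω → ℝ}

/-- The vector `(f a - f b, ∇f a, ∇f b)`, which vanishes if `a` and `b` are critical points at the
same level. -/
noncomputable def jetDifference (f : Plane → Ω → ℝ) (a b : Plane) : Fin 5 → Ω → ℝ :=
  ![fun ω => fieldJet f a none ω - fieldJet f b none ω, fieldJet f a (some 0),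
    fieldJet f a (some 1), fieldJet f b (some 0), fieldJet f b (some 1)]

lemma sum_mul_jetDifference (ξ : Fin 5 → ℝ) (a b : Plane) (ω : Ω) :
    ∑ i, ξ i * jetDifference f a b i ω
      = ∑ i, differenceCoeff ξ i * fieldJet f (jetPoint a b i) (jetIndex i) ω := by
  simp [Fin.sum_univ_succ, jetDifference, differenceCoeff, jetPoint, jetIndex]
  ring

variable [MeasurableSpace Ω] {P : Measure Ω} [IsProbabilityMeasure P]

/-- On disjoint compact sets, the covariance matrices of `(f a - f b, ∇f a, ∇f b)` are bounded
below. -/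
theorem exists_le_variance_jetDifference (hf : IsStationaryCentredGaussianField f P)
    (hA : SmoothNondegenerateDecaying f P) {K K' : Set Plane} (hK : IsCompact K)
    (hK' : IsCompact K') (hKne : K.Nonempty) (hKne' : K'.Nonempty) (hd : Disjoint K K') :
    ∃ lam : ℝ, 0 < lam ∧ ∀ a ∈ K, ∀ b ∈ K', ∀ ξ : Fin 5 → ℝ,
      lam * ∑ i, ξ i ^ 2 ≤ Var[fun ω => ∑ i, ξ i * jetDifference f a b i ω; P] := by
  let S : Set (Fin 5 → ℝ) := {ξ | ∑ i, ξ i ^ 2 = 1}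
  have hS : IsCompact S := by
    refine Metric.isCompact_of_isClosed_isBounded
      (isClosed_eq (by fun_prop) continuous_const) ?_
    refine (Metric.isBounded_closedBall (x := (0 : Fin 5 → ℝ)) (r := 1)).subset fun c hc => ?_
    rw [mem_closedBall_zero_iff, pi_norm_le_iff_of_nonneg zero_le_one]
    have hc' : ∑ i, c i ^ 2 = 1 := hc
    intro i
    rw [Real.norm_eq_abs, ← sq_le_one_iff_abs_le_one, ← hc']
    exact Finset.single_le_sum (f := fun i => c i ^ 2) (fun i _ => sq_nonneg _)
      (Finset.mem_univ i)
  have hSne : S.Nonempty := ⟨![1, 0, 0, 0, 0], by simp [S, Fin.sum_univ_succ]⟩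
  let V : Plane × Plane × (Fin 5 → ℝ) → ℝ := fun p =>
    Var[fun ω => ∑ i, differenceCoeff p.2.2 i * fieldJet f (jetPoint p.1 p.2.1 i) (jetIndex i) ω; P]
  have hV : Continuous V := by
    refine hf.continuous_variance_sum_fieldJet hA.smooth
      (c := fun p : Plane × Plane × (Fin 5 → ℝ) => differenceCoeff p.2.2)
      (x := fun p => jetPoint p.1 p.2.1) ?_ ?_ jetIndex
    · refine continuous_pi fun i => ?_
      fin_cases i <;> simp [differenceCoeff] <;> fun_prop
    · refine continuous_pi fun i => ?_
      fin_cases i <;> simp [jetPoint] <;> fun_prop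
  obtain ⟨p, hp, hmin⟩ := (hK.prod (hK'.prod hS)).exists_isMinOn
    (hKne.prod (hKne'.prod hSne)) hV.continuousOn
  refine ⟨V p, ?_, fun a ha b hb ξ => ?_⟩
  · refine variance_sum_jetPoint_pos hf hA ?_ (differenceCoeff_ne_zero ?_)
    · intro h
      exact Set.disjoint_left.1 hd hp.1 (h ▸ hp.2.1)
    · intro h
      have : ∑ i, p.2.2 i ^ 2 = 1 := hp.2.2
      rw [h] at this
      simp at this
  · by_cases hξ : ∑ i, ξ i ^ 2 = 0
    · rw [hξ, mul_zero]; exact variance_nonneg _ _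
    have hpos : 0 < ∑ i, ξ i ^ 2 :=
      lt_of_le_of_ne (Finset.sum_nonneg fun i _ => sq_nonneg _) (Ne.symm hξ)
    set r := Real.sqrt (∑ i, ξ i ^ 2)
    have hr : 0 < r := Real.sqrt_pos.2 hpos
    have hr2 : r ^ 2 = ∑ i, ξ i ^ 2 := Real.sq_sqrt hpos.le
    have hη : (fun i => r⁻¹ * ξ i) ∈ S := by
      change ∑ i, (r⁻¹ * ξ i) ^ 2 = 1
      simp_rw [mul_pow]
      rw [← Finset.mul_sum, ← hr2]
      field_simp
    have hm : V p ≤ V (a, b, fun i => r⁻¹ * ξ i) := hmin ⟨ha, hb, hη⟩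
    have e1 : V (a, b, fun i => r⁻¹ * ξ i)
        = (r⁻¹) ^ 2 * Var[fun ω => ∑ i, ξ i * jetDifference f a b i ω; P] := by
      rw [← variance_const_mul]
      simp only [V]
      congr 1
      ext ω
      rw [← sum_mul_jetDifference, Finset.mul_sum]
      exact Finset.sum_congr rfl fun i _ => by ring
    rw [e1] at hm
    rw [← hr2]
    calc V p * r ^ 2
        ≤ (r⁻¹ ^ 2 * Var[fun ω => ∑ i, ξ i * jetDifference f a b i ω; P]) * r ^ 2 := by gcongr
      _ = _ := by field_simp

/-- Almost surely, no two critical points in two disjoint squares are at the same level: this is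
Bulinskaya's argument, with five equations in four unknowns. A solution forces the vector
`(f a - f b, ∇f a, ∇f b)` to be of size `O(1 / n)` at one of the `n ^ 4` pairs of mesh points, and
at each of them this has probability `O(1 / n ^ 5)`. -/
theorem ae_level_ne_of_disjoint (hf : IsStationaryCentredGaussianField f P)
    (hA : SmoothNondegenerateDecaying f P) {z z' : Plane}
    (hd : Disjoint (unitSquare z) (unitSquare z')) :
    ∀ᵐ ω ∂P, ∀ a ∈ unitSquare z, ∀ b ∈ unitSquare z', gradient (fun x => f x ω) a = 0 →
      gradient (fun x => f x ω) b = 0 → f a ω ≠ f b ω := by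
  obtain ⟨lam, hlam, hV⟩ := exists_le_variance_jetDifference hf hA (isCompact_unitSquare z)
    (isCompact_unitSquare z') ⟨z, by simp [unitSquare]⟩ ⟨z', by simp [unitSquare]⟩ hd
  -- the jets are Lipschitz on the squares with an integer constant
  let Lip : ℕ → Ω → Prop := fun L ω => ∀ k, ∀ w ∈ ({z, z'} : Set Plane), ∀ a ∈ unitSquare w,
    ∀ b ∈ unitSquare w, |fieldJet f a k ω - fieldJet f b k ω| ≤ L * ‖a - b‖
  have hLip : ∀ ω, ContDiff ℝ 3 (fun x => f x ω) → ∃ L : ℕ, 0 < L ∧ Lip L ω := by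
    intro ω hω
    have h1 : ∀ k w, ∃ C : NNReal, LipschitzOnWith C (fun x => fieldJet f x k ω) (unitSquare w) :=
      fun k w => LocallyLipschitzOn.exists_lipschitzOnWith_of_compact (isCompact_unitSquare w)
        (((contDiff_fieldJet hω k).of_le (by norm_num)).locallyLipschitz.locallyLipschitzOn)
    choose C hC using h1
    obtain ⟨L, hL⟩ := exists_nat_gt (∑ k, (C k z + C k z'))
    refine ⟨L, by exact_mod_cast (zero_le (a := _)).trans_lt hL, fun k w hw a ha b hb => ?_⟩
    have h2 := (hC k w).dist_le_mul a ha b hb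
    rw [Real.dist_eq, dist_eq_norm] at h2
    refine h2.trans (mul_le_mul_of_nonneg_right ?_ (norm_nonneg _))
    have h3 : C k z + C k z' ≤ ∑ k, (C k z + C k z') :=
      Finset.single_le_sum (f := fun k => C k z + C k z') (fun i _ => zero_le) (Finset.mem_univ k)
    have h4 : C k w ≤ C k z + C k z' := by
      rcases hw with rfl | rfl
      · exact le_self_add
      · exact le_add_self
    exact_mod_cast (h4.trans h3).trans hL.le
  let Bad : ℕ → Set Ω := fun L => {ω | Lip L ω ∧ ∃ a ∈ unitSquare z, ∃ b ∈ unitSquare z',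
    gradient (fun x => f x ω) a = 0 ∧ gradient (fun x => f x ω) b = 0 ∧ f a ω = f b ω}
  have hcover : ∀ (L n : ℕ), 0 < L → 0 < n → P.real (Bad L)
      ≤ (n : ℝ) ^ 4 * (Real.exp (5 / 2) * ((8 * L / n) / Real.sqrt lam) ^ 5) := by
    intro L n hL hn
    have hn' : (0 : ℝ) < n := by exact_mod_cast hn
    have hL' : (0 : ℝ) < L := by exact_mod_cast hL
    have hsub : Bad L ⊆ ⋃ p : (Fin n × Fin n) × (Fin n × Fin n),
        {ω | ∀ i, |jetDifference f (meshPoint z n p.1) (meshPoint z' n p.2) i ω| ≤ 8 * L / n} := by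
      rintro ω ⟨hω, a, ha, b, hb, ga, gb, hab⟩
      obtain ⟨p, hp⟩ := exists_meshPoint ha hn
      obtain ⟨q, hq⟩ := exists_meshPoint hb hn
      have ha' : ∀ k, |fieldJet f a k ω - fieldJet f (meshPoint z n p) k ω| ≤ 4 * L / n :=
        fun k => (hω k z (by simp) a ha _ (meshPoint_mem z n p)).trans <| by
          calc (L : ℝ) * ‖a - meshPoint z n p‖ ≤ L * (4 / n) := by gcongr
            _ = _ := by ring
      have hb' : ∀ k, |fieldJet f b k ω - fieldJet f (meshPoint z' n q) k ω| ≤ 4 * L / n :=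
        fun k => (hω k z' (by simp) b hb _ (meshPoint_mem z' n q)).trans <| by
          calc (L : ℝ) * ‖b - meshPoint z' n q‖ ≤ L * (4 / n) := by gcongr
            _ = _ := by ring
      have ga' : ∀ j, fieldJet f a (some j) ω = 0 := fun j => by
        simp [fieldJet, fieldGradient, ga]
      have gb' : ∀ j, fieldJet f b (some j) ω = 0 := fun j => by
        simp [fieldJet, fieldGradient, gb]
      have hab' : fieldJet f a none ω = fieldJet f b none ω := hab
      have h48 : 4 * (L : ℝ) / n ≤ 8 * L / n := by gcongr; norm_num
      have hsum : 8 * (L : ℝ) / n = 4 * L / n + 4 * L / n := by ring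
      refine Set.mem_iUnion.2 ⟨(p, q), fun i => ?_⟩
      fin_cases i
      · change |fieldJet f (meshPoint z n p) none ω - fieldJet f (meshPoint z' n q) none ω| ≤ _
        have h1 := abs_le.1 (ha' none)
        have h2 := abs_le.1 (hb' none)
        rw [abs_le]
        constructor <;> linarith
      · have := ha' (some 0); rw [ga', zero_sub, abs_neg] at this; exact this.trans h48
      · have := ha' (some 1); rw [ga', zero_sub, abs_neg] at this; exact this.trans h48
      · have := hb' (some 0); rw [gb', zero_sub, abs_neg] at this; exact this.trans h48
      · have := hb' (some 1); rw [gb', zero_sub, abs_neg] at this; exact this.trans h48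
    have hball : ∀ p : (Fin n × Fin n) × (Fin n × Fin n),
        P.real {ω | ∀ i, |jetDifference f (meshPoint z n p.1) (meshPoint z' n p.2) i ω| ≤ 8 * L / n}
          ≤ Real.exp (5 / 2) * ((8 * L / n) / Real.sqrt lam) ^ 5 := by
      intro p
      have hGauss : ∀ ξ : Fin 5 → ℝ, IsCentredGaussian (fun ω => ∑ i, ξ i *
          jetDifference f (meshPoint z n p.1) (meshPoint z' n p.2) i ω) P := fun ξ => by
        simp_rw [sum_mul_jetDifference]
        exact hf.isCentredGaussian_sum_fieldJet hA.smooth _ _ _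
      have hmeas : ∀ i, AEMeasurable
          (jetDifference f (meshPoint z n p.1) (meshPoint z' n p.2) i) P := fun i => by
        simpa [Pi.single_apply] using (hGauss (Pi.single i 1)).aemeasurable
      have := measure_forall_abs_le_le hlam (δ := 8 * L / n) (by positivity) hmeas hGauss
        (hV _ (meshPoint_mem z n p.1) _ (meshPoint_mem z' n p.2))
      exact_mod_cast this
    calc P.real (Bad L) ≤ P.real (⋃ p : (Fin n × Fin n) × (Fin n × Fin n), _) :=
          measureReal_mono hsub
      _ ≤ ∑ p : (Fin n × Fin n) × (Fin n × Fin n), _ := measureReal_iUnion_fintype_le _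
      _ ≤ ∑ _p : (Fin n × Fin n) × (Fin n × Fin n), _ := Finset.sum_le_sum fun p _ => hball p
      _ = _ := by
        rw [Finset.sum_const, Finset.card_univ, nsmul_eq_mul]
        simp only [Fintype.card_prod, Fintype.card_fin]
        push_cast
        ring
  have hBad : ∀ L, 0 < L → P (Bad L) = 0 := by
    intro L hL
    have ht : Tendsto (fun n : ℕ => (n : ℝ) ^ 4 *
        (Real.exp (5 / 2) * ((8 * L / n) / Real.sqrt lam) ^ 5)) atTop (𝓝 0) := by
      have := tendsto_const_div_atTop_nhds_zero_nat
        (Real.exp (5 / 2) * (8 * L / Real.sqrt lam) ^ 5)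
      refine this.congr' ?_
      filter_upwards [eventually_gt_atTop 0] with n hn
      have hn' : (n : ℝ) ≠ 0 := by exact_mod_cast hn.ne'
      field_simp
    have h0 : P.real (Bad L) ≤ 0 := ge_of_tendsto ht (by
      filter_upwards [eventually_gt_atTop 0] with n hn using hcover L n hL hn)
    have h1 : P.real (Bad L) = 0 := le_antisymm h0 measureReal_nonneg
    exact (measureReal_eq_zero_iff (measure_ne_top P _)).1 h1
  have hall : ∀ᵐ ω ∂P, ∀ L, 0 < L → ω ∉ Bad L := by
    rw [ae_all_iff]
    intro L
    by_cases hL : 0 < L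
    · filter_upwards [measure_eq_zero_iff_ae_notMem.1 (hBad L hL)] with ω hω _ using hω
    · exact ae_of_all _ fun ω h => absurd h hL
  filter_upwards [hall, hA.smooth] with ω hω hs a ha b hb ga gb hab
  obtain ⟨L, hL, hLω⟩ := hLip ω hs
  exact hω L hL ⟨hLω, a, ha, b, hb, ga, gb, hab⟩

end

/-! ### Counting sign changes of a derivative along a grid -/

section

/-- The points of the subdivision of `[-π, π]` into `2 ^ n` intervals of equal length. -/
noncomputable def gridAngle (n k : ℕ) : ℝ := -Real.pi + k * (2 * Real.pi / 2 ^ n)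

lemma gridAngle_succ_sub (n k : ℕ) :
    gridAngle n (k + 1) - gridAngle n k = 2 * Real.pi / 2 ^ n := by
  simp only [gridAngle]; push_cast; ring

lemma gridAngle_mono (n : ℕ) : Monotone (gridAngle n) := by
  intro a b hab
  have : (a : ℝ) ≤ b := by exact_mod_cast hab
  have hp : 0 ≤ 2 * Real.pi / 2 ^ n := by positivity
  simp only [gridAngle]
  nlinarith

lemma exists_gridAngle_near (n : ℕ) {a : ℝ} (h1 : -Real.pi ≤ a) (h2 : a ≤ Real.pi) :
    ∃ k ≤ 2 ^ n, |gridAngle n k - a| ≤ 2 * Real.pi / 2 ^ n := by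
  set m := 2 * Real.pi / 2 ^ n with hm
  have hmpos : 0 < m := by positivity
  have hnn : 0 ≤ (a + Real.pi) / m := div_nonneg (by linarith) hmpos.le
  have hfl := Nat.floor_le hnn
  have hlf := Nat.lt_floor_add_one ((a + Real.pi) / m)
  rw [le_div_iff₀ hmpos] at hfl
  rw [div_lt_iff₀ hmpos] at hlf
  refine ⟨⌊(a + Real.pi) / m⌋₊, ?_, ?_⟩
  · apply Nat.floor_le_of_le
    rw [div_le_iff₀ hmpos, hm]
    push_cast
    field_simp
    linarith
  · simp only [gridAngle, ← hm]
    rw [abs_le]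
    constructor <;> linarith

lemma exists_sign_change_of_mul_neg {s : ℕ → ℝ} {i j : ℕ} (hij : i ≤ j) (hs : ∀ k, s k ≠ 0)
    (h : s i * s j < 0) : ∃ k, i ≤ k ∧ k < j ∧ s k * s (k + 1) < 0 := by
  induction j, hij using Nat.le_induction with
  | base => exact absurd h (not_lt.2 (mul_self_nonneg _))
  | succ j hij ih =>
    by_cases hneg : s i * s j < 0
    · obtain ⟨k, h1, h2, h3⟩ := ih hneg
      exact ⟨k, h1, h2.trans j.lt_succ_self, h3⟩
    · refine ⟨j, hij, j.lt_succ_self, ?_⟩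
      have hpos : 0 < s i * s j := lt_of_le_of_ne (not_lt.1 hneg) (mul_ne_zero (hs i) (hs j)).symm
      have : (s i * s j) * (s i * s (j + 1)) < 0 := mul_neg_of_pos_of_neg hpos h
      have h2 : 0 < s i ^ 2 := by have := hs i; positivity
      by_contra! hcon
      nlinarith

/-- If `g` takes equal values at the ends of an interval and its derivative vanishes at no point of
the dyadic subdivisions, then every fine enough subdivision detects, inside the interval, a change
of sign of the derivative. -/
lemma exists_forall_sign_change {g g' : ℝ → ℝ} (hg : ∀ t, HasDerivAt g (g' t) t)
    (hc : Continuous g') (h0 : ∀ n k, g' (gridAngle n k) ≠ 0) {a b : ℝ} (ha : -Real.pi ≤ a)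
    (hab : a < b) (hb : b ≤ Real.pi) (heq : g a = g b) :
    ∃ n₀, ∀ n ≥ n₀, ∃ k < 2 ^ n, gridAngle n k ∈ Set.Ioo a b ∧ gridAngle n (k + 1) ∈ Set.Ioo a b ∧
      g' (gridAngle n k) * g' (gridAngle n (k + 1)) < 0 := by
  have hmesh : Tendsto (fun n : ℕ => 2 * Real.pi / 2 ^ n) atTop (𝓝 0) := by
    have := (tendsto_pow_atTop_nhds_zero_of_lt_one (r := (1 / 2 : ℝ)) (by norm_num)
      (by norm_num)).const_mul (2 * Real.pi)
    rw [mul_zero] at this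
    refine this.congr fun n => ?_
    rw [one_div, inv_pow]; rfl
  -- an open subset of the interval contains points of all fine subdivisions
  have hnear : ∀ U : Set ℝ, IsOpen U → ∀ c ∈ U ∩ Set.Ioo a b, ∃ n₀, ∀ n ≥ n₀, ∃ k ≤ 2 ^ n,
      gridAngle n k ∈ U ∩ Set.Ioo a b := by
    intro U hU c hcU
    obtain ⟨r, hr, hball⟩ := Metric.isOpen_iff.1 (hU.inter isOpen_Ioo) c hcU
    obtain ⟨n₀, hn₀⟩ := eventually_atTop.1 (hmesh.eventually (gt_mem_nhds hr))
    refine ⟨n₀, fun n hn => ?_⟩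
    obtain ⟨k, hk, hkc⟩ := exists_gridAngle_near n (a := c) (by linarith [hcU.2.1])
      (by linarith [hcU.2.2])
    exact ⟨k, hk, hball (by rw [Metric.mem_ball, Real.dist_eq]; exact hkc.trans_lt (hn₀ n hn))⟩
  obtain ⟨m, hm⟩ := hnear Set.univ isOpen_univ ((a + b) / 2)
    ⟨trivial, by constructor <;> linarith⟩
  obtain ⟨k₀, -, hk₀⟩ := hm m le_rfl
  have hgc : Continuous g := continuous_iff_continuousAt.2 fun t => (hg t).continuousAt
  have hderiv : ∀ t, deriv g t = g' t := fun t => (hg t).deriv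
  have hconst : ∀ G : ℝ → ℝ, MonotoneOn G (Set.Icc a b) → G a = G b →
      ∀ t ∈ Set.Icc a b, G t = G a := fun G hG hGe t ht =>
    le_antisymm (hGe ▸ hG ht (Set.right_mem_Icc.2 hab.le) ht.2)
      (hG (Set.left_mem_Icc.2 hab.le) ht ht.1)
  have hzero : (∀ t ∈ Set.Icc a b, g t = g a) → False := by
    intro hall
    apply h0 m k₀
    have : g =ᶠ[𝓝 (gridAngle m k₀)] fun _ => g a := by
      filter_upwards [isOpen_Ioo.mem_nhds hk₀.2] with t ht using hall t ⟨ht.1.le, ht.2.le⟩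
    rw [← hderiv, this.deriv_eq, deriv_const]
  have hposex : ∃ c ∈ Set.Ioo a b, 0 < g' c := by
    by_contra! hcon
    have hanti : AntitoneOn g (Set.Icc a b) := antitoneOn_of_deriv_nonpos (convex_Icc a b)
      hgc.continuousOn (fun t _ => (hg t).differentiableAt.differentiableWithinAt) fun t ht => by
        rw [interior_Icc] at ht
        rw [hderiv]
        exact hcon t ht
    refine hzero fun t ht => ?_
    have := hconst (fun t => -g t) hanti.neg (by simp [heq]) t ht
    simpa using this
  have hnegex : ∃ c ∈ Set.Ioo a b, g' c < 0 := by
    by_contra! hcon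
    have hmono : MonotoneOn g (Set.Icc a b) := monotoneOn_of_deriv_nonneg (convex_Icc a b)
      hgc.continuousOn (fun t _ => (hg t).differentiableAt.differentiableWithinAt) fun t ht => by
        rw [interior_Icc] at ht
        rw [hderiv]
        exact hcon t ht
    exact hzero fun t ht => hconst g hmono heq t ht
  obtain ⟨c, hc1, hc2⟩ := hposex
  obtain ⟨d, hd1, hd2⟩ := hnegex
  obtain ⟨n₁, hn₁⟩ := hnear {t | 0 < g' t} (isOpen_lt continuous_const hc) c ⟨hc2, hc1⟩
  obtain ⟨n₂, hn₂⟩ := hnear {t | g' t < 0} (isOpen_lt hc continuous_const) d ⟨hd2, hd1⟩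
  refine ⟨max n₁ n₂, fun n hn => ?_⟩
  obtain ⟨i, hi, hi1, hi2⟩ := hn₁ n ((le_max_left _ _).trans hn)
  obtain ⟨j, hj, hj1, hj2⟩ := hn₂ n ((le_max_right _ _).trans hn)
  have hi1' : 0 < g' (gridAngle n i) := hi1
  have hj1' : g' (gridAngle n j) < 0 := hj1
  have hmain : ∀ i j : ℕ, i ≤ j → j ≤ 2 ^ n → gridAngle n i ∈ Set.Ioo a b →
      gridAngle n j ∈ Set.Ioo a b → g' (gridAngle n i) * g' (gridAngle n j) < 0 →
      ∃ k < 2 ^ n, gridAngle n k ∈ Set.Ioo a b ∧ gridAngle n (k + 1) ∈ Set.Ioo a b ∧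
        g' (gridAngle n k) * g' (gridAngle n (k + 1)) < 0 := by
    intro i j hij hj hi2 hj2 hneg
    obtain ⟨k, hik, hkj, hk⟩ := exists_sign_change_of_mul_neg
      (s := fun k => g' (gridAngle n k)) hij (h0 n) hneg
    exact ⟨k, hkj.trans_le hj,
      ⟨hi2.1.trans_le (gridAngle_mono n hik), (gridAngle_mono n hkj.le).trans_lt hj2.2⟩,
      ⟨hi2.1.trans_le (gridAngle_mono n (hik.trans k.le_succ)),
        (gridAngle_mono n hkj).trans_lt hj2.2⟩, hk⟩
  rcases le_total i j with hij | hij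
  · exact hmain i j hij hj hi2 hj2 (mul_neg_of_pos_of_neg hi1' hj1')
  · exact hmain j i hij hi hj2 hi2 (mul_neg_of_neg_of_pos hj1' hi1')

/-- The number of sign changes of `g'` along the `n`-th subdivision. -/
noncomputable def signChanges (g' : ℝ → ℝ) (n : ℕ) : ENNReal :=
  ∑ k ∈ Finset.range (2 ^ n),
    {t : ℝ | t < 0}.indicator (fun _ => (1 : ENNReal))
      (g' (gridAngle n k) * g' (gridAngle n (k + 1)))

/-- The number of disjoint intervals with equal values of `g` at both ends is at most the number of
sign changes of the derivative that are detected by the fine subdivisions. -/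
lemma card_le_liminf_signChanges {g g' : ℝ → ℝ} (hg : ∀ t, HasDerivAt g (g' t) t)
    (hc : Continuous g') (h0 : ∀ n k, g' (gridAngle n k) ≠ 0) (J : Finset (ℝ × ℝ))
    (hJ : ∀ I ∈ J, -Real.pi ≤ I.1 ∧ I.1 < I.2 ∧ I.2 ≤ Real.pi ∧ g I.1 = g I.2)
    (hd : ∀ I ∈ J, ∀ I' ∈ J, I ≠ I' → Disjoint (Set.Ioo I.1 I.2) (Set.Ioo I'.1 I'.2)) :
    (J.card : ENNReal) ≤ liminf (fun n => signChanges g' n) atTop := by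
  classical
  have hex : ∀ I ∈ J, ∃ n₀, ∀ n ≥ n₀, ∃ k < 2 ^ n, gridAngle n k ∈ Set.Ioo I.1 I.2 ∧
      gridAngle n (k + 1) ∈ Set.Ioo I.1 I.2 ∧
      g' (gridAngle n k) * g' (gridAngle n (k + 1)) < 0 := fun I hI =>
    exists_forall_sign_change hg hc h0 (hJ I hI).1 (hJ I hI).2.1 (hJ I hI).2.2.1 (hJ I hI).2.2.2
  choose! n₀ hn₀ using hex
  refine le_liminf_of_le (by isBoundedDefault) ?_
  filter_upwards [eventually_ge_atTop (J.sup n₀)] with n hn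
  have hk : ∀ I ∈ J, ∃ k < 2 ^ n, gridAngle n k ∈ Set.Ioo I.1 I.2 ∧
      g' (gridAngle n k) * g' (gridAngle n (k + 1)) < 0 := fun I hI => by
    obtain ⟨k, h1, h2, -, h3⟩ := hn₀ I hI n ((Finset.le_sup hI).trans hn)
    exact ⟨k, h1, h2, h3⟩
  choose! k hk1 hk2 hk3 using hk
  have hinj : Set.InjOn k J := by
    intro I hI I' hI' hII
    by_contra hne
    have h1 := hk2 I hI
    rw [hII] at h1
    exact Set.disjoint_left.1 (hd I hI I' hI' hne) h1 (hk2 I' hI')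
  calc (J.card : ENNReal) = ((J.image k).card : ENNReal) := by
        rw [Finset.card_image_of_injOn hinj]
    _ = ∑ i ∈ J.image k, (1 : ENNReal) := by simp
    _ = ∑ i ∈ J.image k, {t : ℝ | t < 0}.indicator (fun _ => (1 : ENNReal))
          (g' (gridAngle n i) * g' (gridAngle n (i + 1))) := by
        refine Finset.sum_congr rfl fun i hi => ?_
        obtain ⟨I, hI, rfl⟩ := Finset.mem_image.1 hi
        rw [Set.indicator_of_mem (show _ ∈ {t : ℝ | t < 0} from hk3 I hI)]
    _ ≤ signChanges g' n := by
        refine Finset.sum_le_sum_of_subset fun i hi => ?_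
        obtain ⟨I, hI, rfl⟩ := Finset.mem_image.1 hi
        exact Finset.mem_range.2 (hk1 I hI)

end

/-! ### Arcs of a circle with equal values at the end points -/

section

/-- The point of polar angle `θ` on the circle of radius `ρ` about the origin. -/
noncomputable def circlePoint (ρ θ : ℝ) : Plane := !₂[ρ * Real.cos θ, ρ * Real.sin θ]

/-- The coordinates of the unit tangent vector of the circle at polar angle `θ`. -/
noncomputable def circleTangent (θ : ℝ) : Fin 2 → ℝ := ![-Real.sin θ, Real.cos θ]

variable {Ω : Type*} {f : Plane → Ω → ℝ}

/-- The tangential derivative of the field at a point of the circle of radius `ρ`. -/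
noncomputable def tangentialDeriv (f : Plane → Ω → ℝ) (ρ θ : ℝ) (ω : Ω) : ℝ :=
  ∑ j, circleTangent θ j * fieldJet f (circlePoint ρ θ) (some j) ω

lemma norm_circlePoint_sub_le {ρ : ℝ} (hρ : 0 ≤ ρ) (θ φ : ℝ) :
    ‖circlePoint ρ θ - circlePoint ρ φ‖ ≤ 2 * ρ * |θ - φ| := by
  have h1 : |Real.cos θ - Real.cos φ| ≤ |θ - φ| := by
    simpa [Real.dist_eq] using Real.lipschitzWith_cos.dist_le_mul θ φ
  have h2 : |Real.sin θ - Real.sin φ| ≤ |θ - φ| := by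
    simpa [Real.dist_eq] using Real.lipschitzWith_sin.dist_le_mul θ φ
  rw [EuclideanSpace.norm_eq, Fin.sum_univ_two, Real.norm_eq_abs, Real.norm_eq_abs]
  apply Real.sqrt_le_iff.2
  refine ⟨by positivity, ?_⟩
  simp only [circlePoint, PiLp.sub_apply, Matrix.cons_val_zero, Matrix.cons_val_one, sq_abs]
  have h1' : (Real.cos θ - Real.cos φ) ^ 2 ≤ |θ - φ| ^ 2 := by
    rw [← sq_abs]; exact pow_le_pow_left₀ (abs_nonneg _) h1 2
  have h2' : (Real.sin θ - Real.sin φ) ^ 2 ≤ |θ - φ| ^ 2 := by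
    rw [← sq_abs]; exact pow_le_pow_left₀ (abs_nonneg _) h2 2
  have hρ2 := sq_nonneg ρ
  calc (ρ * Real.cos θ - ρ * Real.cos φ) ^ 2 + (ρ * Real.sin θ - ρ * Real.sin φ) ^ 2
      = ρ ^ 2 * ((Real.cos θ - Real.cos φ) ^ 2 + (Real.sin θ - Real.sin φ) ^ 2) := by ring
    _ ≤ ρ ^ 2 * (|θ - φ| ^ 2 + |θ - φ| ^ 2) := by gcongr
    _ ≤ (2 * ρ * |θ - φ|) ^ 2 := by nlinarith [mul_nonneg hρ2 (sq_nonneg |θ - φ|)]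

lemma hasDerivAt_circlePoint (ρ θ : ℝ) : HasDerivAt (circlePoint ρ)
    (∑ j, (ρ * circleTangent θ j) • (EuclideanSpace.single j 1 : Plane)) θ := by
  have h : ∀ t, circlePoint ρ t = (ρ * Real.cos t) • (EuclideanSpace.single 0 1 : Plane)
      + (ρ * Real.sin t) • (EuclideanSpace.single 1 1 : Plane) := by
    intro t
    ext j
    fin_cases j <;> simp [circlePoint]
  rw [show circlePoint ρ = _ from funext h, Fin.sum_univ_two]
  exact (((Real.hasDerivAt_cos θ).const_mul ρ).smul_const _).add
    (((Real.hasDerivAt_sin θ).const_mul ρ).smul_const _)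

lemma hasDerivAt_field_circlePoint {ω : Ω} (h : ContDiff ℝ 3 fun x => f x ω) (ρ θ : ℝ) :
    HasDerivAt (fun t => f (circlePoint ρ t) ω) (ρ * tangentialDeriv f ρ θ ω) θ := by
  have hd : HasFDerivAt (fun x => f x ω) (fderiv ℝ (fun x => f x ω) (circlePoint ρ θ))
      (circlePoint ρ θ) := (h.differentiable (by norm_num) _).hasFDerivAt
  have := hd.comp_hasDerivAt θ (hasDerivAt_circlePoint ρ θ)
  refine this.congr_deriv ?_
  simp only [tangentialDeriv, fieldJet, fieldGradient, gradient_apply_eq_fderiv, map_sum, map_smul,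
    Finset.mul_sum, smul_eq_mul]
  exact Finset.sum_congr rfl fun j _ => by ring

lemma continuous_circlePoint (ρ : ℝ) : Continuous (circlePoint ρ) :=
  continuous_iff_continuousAt.2 fun θ => (hasDerivAt_circlePoint ρ θ).continuousAt

lemma continuous_tangentialDeriv {ω : Ω} (h : ContDiff ℝ 3 fun x => f x ω) (ρ : ℝ) :
    Continuous fun θ => tangentialDeriv f ρ θ ω := by
  refine continuous_finsetSum _ fun j _ => Continuous.mul ?_
    ((contDiff_fieldJet h (some j)).continuous.comp (continuous_circlePoint ρ))
  fin_cases j <;> simp [circleTangent] <;> fun_prop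

variable [MeasurableSpace Ω] {P : Measure Ω} [IsProbabilityMeasure P]

lemma variance_fun_add_le {X Y : Ω → ℝ} (hX : MemLp X 2 P) (hY : MemLp Y 2 P) :
    Var[fun ω => X ω + Y ω; P] ≤ 2 * Var[X; P] + 2 * Var[Y; P] := by
  have h1 := variance_fun_add hX hY
  have h2 := variance_fun_sub hX hY
  have h3 := variance_nonneg (fun ω => X ω - Y ω) P
  linarith

/-- The tangential derivatives at two points of the circle of radius `ρ ≥ 1` have opposite signs
with a probability at most proportional to the length of the arc between them. -/
theorem exists_measure_tangentialDeriv_mul_neg_le (hf : IsStationaryCentredGaussianField f P)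
    (hA : SmoothNondegenerateDecaying f P) :
    ∃ C : ℝ, 0 < C ∧ ∀ ρ : ℝ, 1 ≤ ρ → ∀ θ φ : ℝ, θ ≠ φ →
      P {ω | tangentialDeriv f ρ θ ω * tangentialDeriv f ρ φ ω < 0}
        ≤ ENNReal.ofReal (C * ρ * |θ - φ|) := by
  obtain ⟨lam, hlam, hV⟩ := exists_le_variance_directional hf hA
  choose B hB0 hB using fun j : Fin 2 => hf.exists_variance_fieldJet_sub_le hA.smooth (some j)
  let v : Fin 2 → ℝ := fun j => Var[fieldJet f 0 (some j); P]
  have hv : ∀ j, 0 ≤ v j := fun j => variance_nonneg _ _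
  have hmem : ∀ x j, MemLp (fieldJet f x (some j)) 2 P := fun x j =>
    (hf.isCentredGaussian_fieldJet hA.smooth x _).hasGaussianLaw.memLp_two
  have hvx : ∀ x j, Var[fieldJet f x (some j); P] = v j := fun x j => by
    have := hf.variance_sum_fieldJet_add hA.smooth (J := Unit) (fun _ => 1) (fun _ => 0)
      (fun _ => some j) x
    simpa using this
  let K : ℝ := Real.sqrt (4 * (v 0 + v 1) + 16 * (B 0 + B 1) + 1)
  have hKnn : 0 < 4 * (v 0 + v 1) + 16 * (B 0 + B 1) + 1 := by
    have := hv 0; have := hv 1; have := hB0 0; have := hB0 1; positivity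
  have hK : 0 < K := Real.sqrt_pos.2 hKnn
  refine ⟨4 * K / Real.sqrt lam, by positivity, fun ρ hρ θ φ hne => ?_⟩
  have hρ0 : 0 < ρ := by linarith
  set d := |θ - φ| with hd
  have hdpos : 0 < d := abs_pos.2 (sub_ne_zero.2 hne)
  have htan : ∀ j, (circleTangent θ j - circleTangent φ j) ^ 2 ≤ d ^ 2 := by
    intro j
    rw [← sq_abs]
    refine pow_le_pow_left₀ (abs_nonneg _) ?_ 2
    fin_cases j
    · have := Real.lipschitzWith_sin.dist_le_mul θ φ
      simp only [Real.dist_eq, NNReal.coe_one, one_mul] at this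
      simp only [circleTangent, Fin.zero_eta, Matrix.cons_val_zero]
      rwa [neg_sub_neg, abs_sub_comm]
    · have := Real.lipschitzWith_cos.dist_le_mul θ φ
      simp only [Real.dist_eq, NNReal.coe_one, one_mul] at this
      simpa [circleTangent] using this
  have htan1 : ∀ j, circleTangent φ j ^ 2 ≤ 1 := by
    intro j
    fin_cases j
    · simpa [circleTangent] using Real.sin_sq_le_one φ
    · simpa [circleTangent] using Real.cos_sq_le_one φ
  have hG : ∀ a b : ℝ, IsCentredGaussian
      (fun ω => a * tangentialDeriv f ρ θ ω + b * tangentialDeriv f ρ φ ω) P := by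
    intro a b
    have := hf.isCentredGaussian_sum_fieldJet hA.smooth (J := Bool × Fin 2)
      (fun p => if p.1 then a * circleTangent θ p.2 else b * circleTangent φ p.2)
      (fun p => if p.1 then circlePoint ρ θ else circlePoint ρ φ) (fun p => some p.2)
    refine this.congr (ae_of_all _ fun ω => ?_)
    simp [Fintype.sum_prod_type, tangentialDeriv]
    ring
  have hVθ : lam ≤ Var[tangentialDeriv f ρ θ; P] := by
    refine hV (circlePoint ρ θ) (circleTangent θ) ?_
    simp only [circleTangent, Matrix.cons_val_zero, Matrix.cons_val_one, neg_sq]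
    exact Real.sin_sq_add_cos_sq θ
  -- the difference splits into the rotation of the tangent and the increment of the gradient
  have hterm : ∀ j, Var[fun ω => (circleTangent θ j - circleTangent φ j) *
        fieldJet f (circlePoint ρ θ) (some j) ω + circleTangent φ j *
        (fieldJet f (circlePoint ρ θ) (some j) ω - fieldJet f (circlePoint ρ φ) (some j) ω); P]
      ≤ 2 * (d ^ 2 * v j) + 2 * (B j * (2 * ρ * d) ^ 2) := by
    intro j
    refine (variance_fun_add_le ((hmem _ j).const_mul _)
      (((hmem _ j).sub (hmem _ j)).const_mul _)).trans ?_
    simp only [variance_const_mul]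
    rw [hvx]
    have h1 := htan j
    have h2 := htan1 j
    have h3 : Var[fun ω => fieldJet f (circlePoint ρ θ) (some j) ω
        - fieldJet f (circlePoint ρ φ) (some j) ω; P] ≤ B j * (2 * ρ * d) ^ 2 := by
      refine (hB j _ _).trans (mul_le_mul_of_nonneg_left ?_ (hB0 j))
      exact pow_le_pow_left₀ (norm_nonneg _) (norm_circlePoint_sub_le hρ0.le θ φ) 2
    have h4 := variance_nonneg (fun ω => fieldJet f (circlePoint ρ θ) (some j) ω
        - fieldJet f (circlePoint ρ φ) (some j) ω) P
    have h5 := hv j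
    have e1 : (circleTangent θ j - circleTangent φ j) ^ 2 * v j ≤ d ^ 2 * v j := by gcongr
    have e2 : circleTangent φ j ^ 2 * Var[fun ω => fieldJet f (circlePoint ρ θ) (some j) ω
        - fieldJet f (circlePoint ρ φ) (some j) ω; P] ≤ B j * (2 * ρ * d) ^ 2 :=
      (mul_le_of_le_one_left h4 h2).trans h3
    exact add_le_add (mul_le_mul_of_nonneg_left e1 (by norm_num))
      (mul_le_mul_of_nonneg_left e2 (by norm_num))
  have hD : Var[fun ω => tangentialDeriv f ρ θ ω - tangentialDeriv f ρ φ ω; P]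
      ≤ (K * ρ * d) ^ 2 := by
    have hsplit : (fun ω => tangentialDeriv f ρ θ ω - tangentialDeriv f ρ φ ω) = fun ω =>
        ((circleTangent θ 0 - circleTangent φ 0) *
        fieldJet f (circlePoint ρ θ) (some 0) ω + circleTangent φ 0 *
        (fieldJet f (circlePoint ρ θ) (some 0) ω - fieldJet f (circlePoint ρ φ) (some 0) ω)) +
        ((circleTangent θ 1 - circleTangent φ 1) *
        fieldJet f (circlePoint ρ θ) (some 1) ω + circleTangent φ 1 *
        (fieldJet f (circlePoint ρ θ) (some 1) ω - fieldJet f (circlePoint ρ φ) (some 1) ω)) := by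
      ext ω
      simp only [tangentialDeriv, Fin.sum_univ_two]
      ring
    have hm : ∀ j, MemLp (fun ω => (circleTangent θ j - circleTangent φ j) *
        fieldJet f (circlePoint ρ θ) (some j) ω + circleTangent φ j *
        (fieldJet f (circlePoint ρ θ) (some j) ω - fieldJet f (circlePoint ρ φ) (some j) ω)) 2 P :=
      fun j => ((hmem _ j).const_mul _).add (((hmem _ j).sub (hmem _ j)).const_mul _)
    rw [hsplit]
    refine (variance_fun_add_le (hm 0) (hm 1)).trans ?_
    have h0 := hterm 0
    have h1 := hterm 1
    have hKsq : K ^ 2 = 4 * (v 0 + v 1) + 16 * (B 0 + B 1) + 1 := Real.sq_sqrt hKnn.le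
    have hρsq : 1 ≤ ρ ^ 2 := one_le_pow₀ hρ
    have hvv : d ^ 2 * (v 0 + v 1) ≤ ρ ^ 2 * (d ^ 2 * (v 0 + v 1)) :=
      le_mul_of_one_le_left (mul_nonneg (sq_nonneg _) (add_nonneg (hv 0) (hv 1))) hρsq
    have hlast : 0 ≤ ρ ^ 2 * d ^ 2 := by positivity
    have hexp : (K * ρ * d) ^ 2 = (4 * (v 0 + v 1) + 16 * (B 0 + B 1) + 1) * ρ ^ 2 * d ^ 2 := by
      rw [mul_pow, mul_pow, hKsq]
    rw [hexp]
    nlinarith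
  have hmain := measure_mul_neg_le hlam (ε := K * ρ * d) (by positivity) hG hVθ hD
  refine hmain.trans (ENNReal.ofReal_le_ofReal (le_of_eq ?_))
  ring

lemma ae_tangentialDeriv_ne_zero (hf : IsStationaryCentredGaussianField f P)
    (hA : SmoothNondegenerateDecaying f P) (ρ θ : ℝ) :
    ∀ᵐ ω ∂P, tangentialDeriv f ρ θ ω ≠ 0 := by
  obtain ⟨lam, hlam, hV⟩ := exists_le_variance_directional hf hA
  have hVθ : lam ≤ Var[tangentialDeriv f ρ θ; P] := by
    refine hV (circlePoint ρ θ) (circleTangent θ) ?_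
    simp only [circleTangent, Matrix.cons_val_zero, Matrix.cons_val_one, neg_sq]
    exact Real.sin_sq_add_cos_sq θ
  have hG : IsCentredGaussian (tangentialDeriv f ρ θ) P :=
    hf.isCentredGaussian_sum_fieldJet hA.smooth _ _ _
  have h := hG.measure_abs_le_le hlam le_rfl hVθ
  rw [zero_div, mul_zero] at h
  have h0 := (measureReal_eq_zero_iff (measure_ne_top P _)).1 (le_antisymm h measureReal_nonneg)
  filter_upwards [measure_eq_zero_iff_ae_notMem.1 h0] with ω hω h1
  exact hω (by simp [h1])

/-- On the circle of radius `ρ ≥ 1`, the number of disjoint arcs whose two ends are at the same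
level is dominated by a random variable of expectation `O(ρ)`: such an arc contains a change of sign
of the tangential derivative. -/
theorem exists_lintegral_le_of_disjoint_arcs (hf : IsStationaryCentredGaussianField f P)
    (hA : SmoothNondegenerateDecaying f P) :
    ∃ C : ℝ, 0 < C ∧ ∀ ρ : ℝ, 1 ≤ ρ → ∃ N : Ω → ENNReal,
      ∫⁻ ω, N ω ∂P ≤ ENNReal.ofReal (C * ρ) ∧
      ∀ᵐ ω ∂P, ∀ J : Finset (ℝ × ℝ),
        (∀ I ∈ J, -Real.pi ≤ I.1 ∧ I.1 < I.2 ∧ I.2 ≤ Real.pi ∧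
          f (circlePoint ρ I.1) ω = f (circlePoint ρ I.2) ω) →
        (∀ I ∈ J, ∀ I' ∈ J, I ≠ I' → Disjoint (Set.Ioo I.1 I.2) (Set.Ioo I'.1 I'.2)) →
        (J.card : ENNReal) ≤ N ω := by
  obtain ⟨C, hC, hneg⟩ := exists_measure_tangentialDeriv_mul_neg_le hf hA
  refine ⟨C * (2 * Real.pi), by positivity, fun ρ hρ => ?_⟩
  have hρ0 : 0 < ρ := by linarith
  have hGm : ∀ θ, AEMeasurable (tangentialDeriv f ρ θ) P := fun θ =>
    (hf.isCentredGaussian_sum_fieldJet hA.smooth _ _ _).aemeasurable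
  have hprod : ∀ n k, AEMeasurable (fun ω => tangentialDeriv f ρ (gridAngle n k) ω *
      tangentialDeriv f ρ (gridAngle n (k + 1)) ω) P := fun n k => (hGm _).mul (hGm _)
  have hneg0 : MeasurableSet {t : ℝ | t < 0} := measurableSet_Iio
  have hind : ∀ n k, AEMeasurable (fun ω => {t : ℝ | t < 0}.indicator (fun _ => (1 : ENNReal))
      (tangentialDeriv f ρ (gridAngle n k) ω * tangentialDeriv f ρ (gridAngle n (k + 1)) ω)) P :=
    fun n k => (measurable_const.indicator hneg0).comp_aemeasurable (hprod n k)
  have hmeas : ∀ n, AEMeasurable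
      (fun ω => signChanges (fun θ => tangentialDeriv f ρ θ ω) n) P := fun n =>
    Finset.aemeasurable_fun_sum _ fun k _ => hind n k
  have hbound : ∀ n, ∫⁻ ω, signChanges (fun θ => tangentialDeriv f ρ θ ω) n ∂P
      ≤ ENNReal.ofReal (C * (2 * Real.pi) * ρ) := by
    intro n
    simp only [signChanges]
    rw [lintegral_finsetSum' _ fun k _ => hind n k]
    have hk : ∀ k ∈ Finset.range (2 ^ n), ∫⁻ ω, {t : ℝ | t < 0}.indicator
        (fun _ => (1 : ENNReal)) (tangentialDeriv f ρ (gridAngle n k) ω *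
          tangentialDeriv f ρ (gridAngle n (k + 1)) ω) ∂P
        ≤ ENNReal.ofReal (C * ρ * (2 * Real.pi / 2 ^ n)) := by
      intro k _
      have hS : NullMeasurableSet {ω | tangentialDeriv f ρ (gridAngle n k) ω *
          tangentialDeriv f ρ (gridAngle n (k + 1)) ω < 0} P :=
        (hprod n k).nullMeasurableSet_preimage hneg0
      have e1 : ∀ ω, {t : ℝ | t < 0}.indicator (fun _ => (1 : ENNReal))
          (tangentialDeriv f ρ (gridAngle n k) ω * tangentialDeriv f ρ (gridAngle n (k + 1)) ω)
          = {ω | tangentialDeriv f ρ (gridAngle n k) ω *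
          tangentialDeriv f ρ (gridAngle n (k + 1)) ω < 0}.indicator 1 ω := fun ω => rfl
      simp_rw [e1]
      rw [lintegral_indicator_one₀ hS]
      have hmesh : 0 < 2 * Real.pi / 2 ^ n := by positivity
      have hlt : gridAngle n k ≠ gridAngle n (k + 1) := by
        have := gridAngle_succ_sub n k
        intro h
        rw [h, sub_self] at this
        linarith
      refine (hneg ρ hρ _ _ hlt).trans (le_of_eq ?_)
      rw [abs_sub_comm, gridAngle_succ_sub, abs_of_pos hmesh]
    refine (Finset.sum_le_sum hk).trans (le_of_eq ?_)
    rw [Finset.sum_const, Finset.card_range, nsmul_eq_mul, ← ENNReal.ofReal_natCast,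
      ← ENNReal.ofReal_mul (by positivity)]
    congr 1
    push_cast
    field_simp
  refine ⟨fun ω => liminf (fun n => signChanges (fun θ => tangentialDeriv f ρ θ ω) n) atTop,
    ?_, ?_⟩
  · refine (lintegral_liminf_le' hmeas).trans ?_
    exact (liminf_le_liminf (Eventually.of_forall hbound)).trans_eq (liminf_const _)
  · have hne : ∀ᵐ ω ∂P, ∀ n k, tangentialDeriv f ρ (gridAngle n k) ω ≠ 0 :=
      ae_all_iff.2 fun n => ae_all_iff.2 fun k => ae_tangentialDeriv_ne_zero hf hA ρ _
    filter_upwards [hne, hA.smooth] with ω hω hs J hJ hd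
    refine card_le_liminf_signChanges (g := fun t => ρ⁻¹ * f (circlePoint ρ t) ω) (fun t => ?_)
      (continuous_tangentialDeriv hs ρ) hω J (fun I hI => ?_) hd
    · have := (hasDerivAt_field_circlePoint hs ρ t).const_mul ρ⁻¹
      rwa [inv_mul_cancel_left₀ hρ0.ne'] at this
    · obtain ⟨h1, h2, h3, h4⟩ := hJ I hI
      exact ⟨h1, h2, h3, by rw [h4]⟩

end

/-! ### Stars and disjoint arcs -/

section

/-- `x` is joined to distance at least `R` by three arms on which `u` is constant and which meet
only at `x`. This is the part of the definition of a saddle point used to count saddle points; the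
arms may leave the disc of radius `R`, need not be injective, and may even be only three. -/
def IsStarCentre (R : ℝ) (u : Plane → ℝ) (x : Plane) : Prop :=
  ∃ γ : Fin 3 → C(unitInterval, Plane), (∀ i, γ i 0 = x) ∧ (∀ i, R ≤ dist (γ i 1) x) ∧
    (∀ i j, i ≠ j → ∀ s t, γ i s = γ j t → γ i s = x) ∧ ∀ i t, u (γ i t) = u x

/-- A path that leaves the open disc of radius `ρ` has a first exit point. -/
lemma exists_first_exit {c : ℝ → Plane} (hc : Continuous c) {ρ : ℝ} (h0 : ‖c 0‖ < ρ)
    (h1 : ρ ≤ ‖c 1‖) :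
    ∃ s ∈ Set.Icc (0 : ℝ) 1, ‖c s‖ = ρ ∧ ∀ t ∈ Set.Icc 0 s, ‖c t‖ ≤ ρ := by
  let T : Set ℝ := Set.Icc 0 1 ∩ {t | ‖c t‖ = ρ}
  have hT : IsCompact T := isCompact_Icc.inter_right (isClosed_eq (by fun_prop) continuous_const)
  have hex : ∀ t, 0 ≤ t → ρ ≤ ‖c t‖ → ∃ s ∈ Set.Icc 0 t, ‖c s‖ = ρ := fun t ht hρ =>
    intermediate_value_Icc ht (f := fun t => ‖c t‖) (by fun_prop) ⟨h0.le, hρ⟩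
  obtain ⟨s₀, hs₀, hs₀'⟩ := hex 1 zero_le_one h1
  obtain ⟨s, ⟨hsI, hs⟩, hmin⟩ := hT.exists_isLeast ⟨s₀, hs₀, hs₀'⟩
  refine ⟨s, hsI, hs, fun t ht => ?_⟩
  by_contra! hcon
  obtain ⟨s', hs', hs'e⟩ := hex t ht.1 hcon.le
  have h2 : s ≤ s' := hmin ⟨⟨hs'.1, (hs'.2.trans ht.2).trans hsI.2⟩, hs'e⟩
  have h3 : t = s := le_antisymm ht.2 (h2.trans hs'.2)
  rw [h3, hs] at hcon
  exact lt_irrefl _ hcon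

lemma exists_angle {ρ : ℝ} {e : Plane} (he : ‖e‖ = ρ) :
    ∃ θ, -Real.pi < θ ∧ θ ≤ Real.pi ∧ e = circlePoint ρ θ := by
  let w : ℂ := ⟨e 0, e 1⟩
  have hw : ‖w‖ = ρ := by
    rw [← he, EuclideanSpace.norm_eq, Fin.sum_univ_two, Complex.norm_def, Complex.normSq_apply]
    simp only [Real.norm_eq_abs, abs_mul_abs_self, w, pow_two]
  refine ⟨w.arg, Complex.neg_pi_lt_arg w, Complex.arg_le_pi w, ?_⟩
  ext j
  fin_cases j
  · have := Complex.norm_mul_cos_arg w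
    rw [hw] at this
    simp [circlePoint, this, w]
  · have := Complex.norm_mul_sin_arg w
    rw [hw] at this
    simp [circlePoint, this, w]

/-- Disjoint subsets of a closed disc cannot both join interlaced pairs of boundary points. -/
lemma not_joinedIn_of_interlaced {ρ : ℝ} (hρ : 0 < ρ) {F F' : Set Plane}
    (hF : F ⊆ Metric.closedBall 0 ρ) (hF' : F' ⊆ Metric.closedBall 0 ρ) (hd : Disjoint F F')
    {s₁ t₁ s₂ t₂ : ℝ} (h1 : s₁ < t₁) (h2 : t₁ < s₂) (h3 : s₂ < t₂) (h4 : t₂ < s₁ + 2 * Real.pi)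
    (hs : JoinedIn F (circlePoint ρ s₁) (circlePoint ρ s₂))
    (ht : JoinedIn F' (circlePoint ρ t₁) (circlePoint ρ t₂)) : False := by
  let toC : Plane → ℂ := fun p => ((p 0 / ρ : ℝ) : ℂ) + ((p 1 / ρ : ℝ) : ℂ) * Complex.I
  have hcont : Continuous toC := by fun_prop
  have hcirc : ∀ θ, toC (circlePoint ρ θ) = Complex.exp (θ * Complex.I) := by
    intro θ
    simp only [toC, circlePoint, Matrix.cons_val_zero, Matrix.cons_val_one]
    rw [mul_div_cancel_left₀ _ hρ.ne', mul_div_cancel_left₀ _ hρ.ne', Complex.exp_mul_I,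
      Complex.ofReal_cos, Complex.ofReal_sin]
  have hnorm : ∀ p ∈ Metric.closedBall (0 : Plane) ρ, ‖toC p‖ ≤ 1 := by
    intro p hp
    rw [mem_closedBall_zero_iff, EuclideanSpace.norm_eq, Fin.sum_univ_two, Real.sqrt_le_iff] at hp
    simp only [toC, Complex.norm_add_mul_I]
    rw [Real.sqrt_le_one, div_pow, div_pow, ← add_div, div_le_one (by positivity)]
    simpa using hp.2
  have hinj : Function.Injective toC := by
    intro p p' hpp
    have hre := congrArg Complex.re hpp
    have him := congrArg Complex.im hpp
    simp [toC, -Complex.ofReal_div, div_left_inj' hρ.ne'] at hre him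
    ext j
    fin_cases j <;> assumption
  have hmem : ∀ {F : Set Plane} {a b : Plane} (h : JoinedIn F a b) (t : ℝ),
      h.somePath.extend t ∈ F := by
    intro F a b h t
    exact h.somePath_mem _
  obtain ⟨s, t, hst⟩ := exists_eq_of_interlaced
    (α := fun s => toC (hs.somePath.extend s)) (β := fun t => toC (ht.somePath.extend t))
    (hcont.comp hs.somePath.continuous_extend) (hcont.comp ht.somePath.continuous_extend)
    (fun s => hnorm _ (hF (hmem hs s))) (fun t => hnorm _ (hF' (hmem ht t))) h1 h2 h3 h4
    (by simp [hcirc]) (by simp [hcirc]) (by simp [hcirc]) (by simp [hcirc])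
  have := hinj hst
  exact Set.disjoint_left.1 hd (hmem hs s) (this ▸ hmem ht t)

/-- The part of a level set in a closed disc about the origin. -/
def levelInDisc (u : Plane → ℝ) (ρ a : ℝ) : Set Plane := Metric.closedBall 0 ρ ∩ {x | u x = a}

/-- The arms of a star leave the disc at three points that are joined in the level set. -/
lemma IsStarCentre.exists_angles {u : Plane → ℝ} {ρ : ℝ} {x : Plane}
    (h : IsStarCentre (2 * ρ) u x) (hx : ‖x‖ < ρ) :
    ∃ p q r : ℝ, p < q ∧ q < r ∧ ∀ s ∈ ({p, q, r} : Set ℝ), (-Real.pi < s ∧ s ≤ Real.pi) ∧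
      ∀ t ∈ ({p, q, r} : Set ℝ),
        JoinedIn (levelInDisc u ρ (u x)) (circlePoint ρ s) (circlePoint ρ t) := by
  have hρ : 0 < ρ := (norm_nonneg x).trans_lt hx
  obtain ⟨γ, h0, h1, hdisj, hlev⟩ := h
  have hexit : ∀ i, ∃ s : unitInterval, ‖γ i s‖ = ρ ∧
      JoinedIn (levelInDisc u ρ (u x)) x (γ i s) := by
    intro i
    let c : ℝ → Plane := fun t => γ i (Set.projIcc 0 1 zero_le_one t)
    have hc : Continuous c := (γ i).continuous.comp continuous_projIcc
    have hc0 : c 0 = x := by simp only [c, Set.projIcc_left]; exact h0 i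
    have hc1 : ρ ≤ ‖c 1‖ := by
      have e1 : c 1 = γ i 1 := by simp only [c, Set.projIcc_right]; rfl
      have := h1 i
      rw [dist_eq_norm] at this
      rw [e1]
      have h2 := norm_sub_le (γ i 1) x
      linarith
    obtain ⟨s, hs, hsρ, hle⟩ := exists_first_exit hc (by rw [hc0]; exact hx) hc1
    refine ⟨Set.projIcc 0 1 zero_le_one s, hsρ, ?_⟩
    refine JoinedIn.ofLine (f := fun t => c (s * t)) (by fun_prop) (by simp [hc0])
      (by simp [c]) ?_
    rintro _ ⟨t, ht, rfl⟩
    refine ⟨?_, hlev i _⟩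
    rw [mem_closedBall_zero_iff]
    exact hle _ ⟨mul_nonneg hs.1 ht.1, mul_le_of_le_one_right hs.1 ht.2⟩
  choose e he hjoin using hexit
  choose θ hθ1 hθ2 hθ using fun i => exists_angle (he i)
  have hinj : Function.Injective θ := by
    intro i j hij
    by_contra hne
    have h2 : γ i (e i) = γ j (e j) := by rw [hθ i, hθ j, hij]
    have h3 := hdisj i j hne _ _ h2
    have h4 := he i
    rw [h3] at h4
    linarith
  have hstrict : StrictMono (θ ∘ Tuple.sort θ) :=
    (Tuple.monotone_sort θ).strictMono_of_injective (hinj.comp (Equiv.injective _))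
  refine ⟨θ (Tuple.sort θ 0), θ (Tuple.sort θ 1), θ (Tuple.sort θ 2), hstrict (by decide),
    hstrict (by decide), ?_⟩
  have key : ∀ s ∈ ({θ (Tuple.sort θ 0), θ (Tuple.sort θ 1), θ (Tuple.sort θ 2)} : Set ℝ),
      ∃ i, s = θ i := by
    rintro s (rfl | rfl | rfl) <;> exact ⟨_, rfl⟩
  intro s hs
  obtain ⟨i, rfl⟩ := key s hs
  refine ⟨⟨hθ1 i, hθ2 i⟩, fun t ht => ?_⟩
  obtain ⟨j, rfl⟩ := key t ht
  rw [← hθ i, ← hθ j]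
  exact (hjoin i).symm.trans (hjoin j)

/-- Star centres in a disc at distinct levels produce as many disjoint arcs of the boundary circle
whose two ends are at the same level: the arms at distinct levels are disjoint, so the triples of
their exit points do not cross. -/
theorem exists_disjoint_arcs_of_isStarCentre {ι : Type*} {u : Plane → ℝ} {ρ : ℝ} (S : Finset ι)
    (x : ι → Plane) (hx : ∀ i ∈ S, ‖x i‖ < ρ) (hstar : ∀ i ∈ S, IsStarCentre (2 * ρ) u (x i))
    (hlev : ∀ i ∈ S, ∀ j ∈ S, i ≠ j → u (x i) ≠ u (x j)) :
    ∃ J : Finset (ℝ × ℝ), S.card ≤ J.card ∧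
      (∀ I ∈ J, -Real.pi ≤ I.1 ∧ I.1 < I.2 ∧ I.2 ≤ Real.pi ∧
        u (circlePoint ρ I.1) = u (circlePoint ρ I.2)) ∧
      (∀ I ∈ J, ∀ I' ∈ J, I ≠ I' → Disjoint (Set.Ioo I.1 I.2) (Set.Ioo I'.1 I'.2)) := by
  have hex : ∀ i, ∃ p q r : ℝ, i ∈ S → p < q ∧ q < r ∧ ∀ s ∈ ({p, q, r} : Set ℝ),
      (-Real.pi < s ∧ s ≤ Real.pi) ∧ ∀ t ∈ ({p, q, r} : Set ℝ),
        JoinedIn (levelInDisc u ρ (u (x i))) (circlePoint ρ s) (circlePoint ρ t) := by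
    intro i
    by_cases hi : i ∈ S
    · obtain ⟨p, q, r, h⟩ := (hstar i hi).exists_angles (hx i hi)
      exact ⟨p, q, r, fun _ => h⟩
    · exact ⟨0, 0, 0, fun h => absurd h hi⟩
  choose p q r hpqr using hex
  have hmemlev : ∀ i ∈ S, ∀ s ∈ ({p i, q i, r i} : Set ℝ), u (circlePoint ρ s) = u (x i) :=
    fun i hi s hs => (((hpqr i hi).2.2 s hs).2 s hs).source_mem.2
  have hdisj : ∀ i ∈ S, ∀ j ∈ S, i ≠ j →
      Disjoint (levelInDisc u ρ (u (x i))) (levelInDisc u ρ (u (x j))) := fun i hi j hj hij =>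
    Set.disjoint_left.2 fun y hy hy' => hlev i hi j hj hij (hy.2.symm.trans hy'.2)
  have hne : ∀ i ∈ S, ∀ j ∈ S, i ≠ j → ∀ s ∈ ({p i, q i, r i} : Set ℝ),
      ∀ t ∈ ({p j, q j, r j} : Set ℝ), s ≠ t := by
    rintro i hi j hj hij s hs t ht rfl
    exact hlev i hi j hj hij ((hmemlev i hi s hs).symm.trans (hmemlev j hj s ht))
  obtain ⟨J, hJc, hJ, hJd⟩ := exists_disjoint_intervals_of_noncrossing
    (fun θ => u (circlePoint ρ θ)) p q r S (fun i hi => (hpqr i hi).1)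
    (fun i hi => (hpqr i hi).2.1)
    (fun i hi => (hmemlev i hi _ (by simp)).trans (hmemlev i hi _ (by simp)).symm)
    (fun i hi => (hmemlev i hi _ (by simp)).trans (hmemlev i hi _ (by simp)).symm) (by
      intro i hi j hj hij s hs t ht hps hsr
      have hρ : 0 < ρ := (norm_nonneg _).trans_lt (hx i hi)
      have hp1 : p i ∈ ({p i, q i, r i} : Set ℝ) := by simp
      have hr1 : r i ∈ ({p i, q i, r i} : Set ℝ) := by simp
      have hps' : p i < s := lt_of_le_of_ne hps (hne i hi j hj hij _ hp1 s hs)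
      have hsr' : s < r i := lt_of_le_of_ne hsr (hne i hi j hj hij _ hr1 s hs).symm
      have hpt := hne i hi j hj hij _ hp1 t ht
      have hrt := hne i hi j hj hij _ hr1 t ht
      have bp := ((hpqr i hi).2.2 _ hp1).1
      have br := ((hpqr i hi).2.2 _ hr1).1
      have bt := ((hpqr j hj).2.2 t ht).1
      have hF : ∀ a, levelInDisc u ρ a ⊆ Metric.closedBall 0 ρ := fun a => Set.inter_subset_left
      by_contra hcon
      rw [not_and_or, not_lt, not_lt] at hcon
      rcases hcon with hcon | hcon
      · exact not_joinedIn_of_interlaced hρ (hF _) (hF _) (hdisj j hj i hi hij.symm)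
          (lt_of_le_of_ne hcon hpt.symm) hps' hsr' (by linarith [br.2, bt.1])
          (((hpqr j hj).2.2 t ht).2 s hs) (((hpqr i hi).2.2 _ hp1).2 _ hr1)
      · exact not_joinedIn_of_interlaced hρ (hF _) (hF _) (hdisj i hi j hj hij)
          hps' hsr' (lt_of_le_of_ne hcon hrt) (by linarith [bt.2, bp.1])
          (((hpqr i hi).2.2 _ hp1).2 _ hr1) (((hpqr j hj).2.2 s hs).2 t ht))
  refine ⟨J, hJc, fun I hI => ?_, hJd⟩
  obtain ⟨h1, h2, ⟨i, hi, hi'⟩, ⟨j, hj, hj'⟩⟩ := hJ I hI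
  exact ⟨((hpqr i hi).2.2 _ hi').1.1.le, h1, ((hpqr j hj).2.2 _ hj').1.2, h2⟩

end

/-! ### Measurability and stationarity of the star events -/

section

lemma nullMeasurableSet_preimage_of_map {Ω X : Type*} [MeasurableSpace Ω] [MeasurableSpace X]
    {P : Measure Ω} {g : Ω → X} (hg : AEMeasurable g P) {T : Set X}
    (hT : NullMeasurableSet T (P.map g)) : NullMeasurableSet (g ⁻¹' T) P := by
  obtain ⟨T', -, hT', hae⟩ := hT.exists_measurable_superset_ae_eq
  have h := ae_of_ae_map hg hae
  refine (hg.nullMeasurableSet_preimage hT').congr ?_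
  filter_upwards [h] with ω hω using hω

/-- Triples of paths in a compact part `K` of the plane, together with the jets along `K` of a
function, that form a star of radius `R` on a level set whose centre is a critical point of norm at
most one. -/
def starConfigurations (R : ℝ) (K : Set Plane) :
    Set (C(K, Option (Fin 2) → ℝ) × (Fin 3 → C(unitInterval, K))) :=
  {q | (∀ i, q.2 i 0 = q.2 0 0) ∧ ‖(q.2 0 0 : Plane)‖ ≤ 1 ∧
    (∀ j : Fin 2, q.1 (q.2 0 0) (some j) = 0) ∧
    (∀ i, R ≤ dist (q.2 i 1 : Plane) (q.2 0 0)) ∧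
    (∀ i t, q.1 (q.2 i t) none = q.1 (q.2 0 0) none) ∧
    ∀ i j, i ≠ j → ∀ s t, q.2 i s = q.2 j t → q.2 i s = q.2 0 0}

lemma measurableSet_starConfigurations (R : ℝ) (K : Set Plane) [CompactSpace K]
    [MeasurableSpace (C(K, Option (Fin 2) → ℝ) × (Fin 3 → C(unitInterval, K)))]
    [BorelSpace (C(K, Option (Fin 2) → ℝ) × (Fin 3 → C(unitInterval, K)))] :
    MeasurableSet (starConfigurations R K) := by
  have hpt : ∀ i t, Continuous fun q : C(K, Option (Fin 2) → ℝ) × (Fin 3 → C(unitInterval, K)) =>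
      q.2 i t := fun i t => by fun_prop
  have hval : ∀ i t k, Continuous
      fun q : C(K, Option (Fin 2) → ℝ) × (Fin 3 → C(unitInterval, K)) => q.1 (q.2 i t) k :=
    fun i t k => by fun_prop
  have hcoe : ∀ i t, Continuous
      fun q : C(K, Option (Fin 2) → ℝ) × (Fin 3 → C(unitInterval, K)) => (q.2 i t : Plane) :=
    fun i t => continuous_subtype_val.comp (hpt i t)
  have hmeet : ∀ i j, MeasurableSet
      {q : C(K, Option (Fin 2) → ℝ) × (Fin 3 → C(unitInterval, K)) |
        ∀ s t, q.2 i s = q.2 j t → q.2 i s = q.2 0 0} := by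
    intro i j
    have heq : {q : C(K, Option (Fin 2) → ℝ) × (Fin 3 → C(unitInterval, K)) |
        ∀ s t, q.2 i s = q.2 j t → q.2 i s = q.2 0 0}
        = ⋂ n : ℕ, (Prod.fst '' {p : (C(K, Option (Fin 2) → ℝ) × (Fin 3 → C(unitInterval, K))) ×
            (unitInterval × unitInterval) | p.1.2 i p.2.1 = p.1.2 j p.2.2 ∧
              1 / ((n : ℝ) + 1) ≤ dist (p.1.2 i p.2.1) (p.1.2 0 0)})ᶜ := by
      ext q
      rw [Set.mem_iInter]
      constructor
      · rintro hq n ⟨⟨q', s, t⟩, ⟨h1, h2⟩, rfl⟩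
        have h3 := hq s t h1
        simp only at h2
        rw [h3, dist_self] at h2
        have : (0 : ℝ) < 1 / ((n : ℝ) + 1) := by positivity
        linarith
      · intro hq s t hst
        by_contra hne
        obtain ⟨n, hn⟩ := exists_nat_one_div_lt (dist_pos.2 hne)
        exact hq n ⟨(q, s, t), ⟨hst, hn.le⟩, rfl⟩
    rw [heq]
    refine MeasurableSet.iInter fun n => (IsClosed.measurableSet ?_).compl
    refine isClosedMap_fst_of_compactSpace _ (IsClosed.inter ?_ ?_)
    · exact isClosed_eq (f := fun p : (C(K, Option (Fin 2) → ℝ) × (Fin 3 → C(unitInterval, K))) ×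
        (unitInterval × unitInterval) => p.1.2 i p.2.1) (g := fun p => p.1.2 j p.2.2)
        (by fun_prop) (by fun_prop)
    · exact isClosed_le (f := fun _ : (C(K, Option (Fin 2) → ℝ) × (Fin 3 → C(unitInterval, K))) ×
        (unitInterval × unitInterval) => 1 / ((n : ℝ) + 1))
        (g := fun p => dist (p.1.2 i p.2.1) (p.1.2 0 0)) continuous_const (by fun_prop)
  have hstart : MeasurableSet {q : C(K, Option (Fin 2) → ℝ) × (Fin 3 → C(unitInterval, K)) |
      ∀ i, q.2 i 0 = q.2 0 0} := by
    rw [Set.ofPred_forall]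
    exact .iInter fun i => (isClosed_eq (hpt i 0) (hpt 0 0)).measurableSet
  have hcrit : MeasurableSet {q : C(K, Option (Fin 2) → ℝ) × (Fin 3 → C(unitInterval, K)) |
      ∀ j : Fin 2, q.1 (q.2 0 0) (some j) = 0} := by
    rw [Set.ofPred_forall]
    exact .iInter fun j => (isClosed_eq (hval 0 0 (some j)) continuous_const).measurableSet
  have hend : MeasurableSet {q : C(K, Option (Fin 2) → ℝ) × (Fin 3 → C(unitInterval, K)) |
      ∀ i, R ≤ dist (q.2 i 1 : Plane) (q.2 0 0)} := by
    rw [Set.ofPred_forall]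
    exact .iInter fun i =>
      (isClosed_le continuous_const ((hcoe i 1).dist (hcoe 0 0))).measurableSet
  have hconst : MeasurableSet {q : C(K, Option (Fin 2) → ℝ) × (Fin 3 → C(unitInterval, K)) |
      ∀ i t, q.1 (q.2 i t) none = q.1 (q.2 0 0) none} := by
    simp only [Set.ofPred_forall]
    exact .iInter fun i => (isClosed_iInter fun t =>
      isClosed_eq (hval i t none) (hval 0 0 none)).measurableSet
  have hdisj : MeasurableSet {q : C(K, Option (Fin 2) → ℝ) × (Fin 3 → C(unitInterval, K)) |
      ∀ i j, i ≠ j → ∀ s t, q.2 i s = q.2 j t → q.2 i s = q.2 0 0} := by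
    rw [Set.ofPred_forall]
    refine .iInter fun i => ?_
    rw [Set.ofPred_forall]
    refine .iInter fun j => ?_
    rw [Set.ofPred_forall]
    exact .iInter fun _ => hmeet i j
  exact hstart.inter ((isClosed_le (hcoe 0 0).norm continuous_const).measurableSet.inter
    (hcrit.inter (hend.inter (hconst.inter hdisj))))

/-- The jets, along a dense sequence of points of `K`, of the functions that have a star as in
`starConfigurations`. -/
def starTraces (R : ℝ) (K : Set Plane) [Nonempty K] : Set (ℕ → Option (Fin 2) → ℝ) :=
  (fun q : C(K, Option (Fin 2) → ℝ) × (Fin 3 → C(unitInterval, K)) =>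
    fun n => q.1 (TopologicalSpace.denseSeq K n)) '' starConfigurations R K

lemma analyticSet_starTraces (R : ℝ) (K : Set Plane) [Nonempty K] [CompactSpace K] :
    AnalyticSet (starTraces R K) := by
  let : MeasurableSpace (C(K, Option (Fin 2) → ℝ) × (Fin 3 → C(unitInterval, K))) := borel _
  have : BorelSpace (C(K, Option (Fin 2) → ℝ) × (Fin 3 → C(unitInterval, K))) := ⟨rfl⟩
  refine (measurableSet_starConfigurations R K).analyticSet.image_of_continuous ?_
  fun_prop

variable {Ω : Type*} {f : Plane → Ω → ℝ}

/-- The field has, in the closed unit disc about `z`, a critical point which is the centre of a star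
of radius `R` on a level set. -/
def starEvent (f : Plane → Ω → ℝ) (R : ℝ) (z : Plane) : Set Ω :=
  {ω | ∃ x ∈ Metric.closedBall z 1, gradient (fun y => f y ω) x = 0 ∧
    IsStarCentre R (fun y => f y ω) x}

instance (m : ℕ) : Nonempty (Metric.closedBall (0 : Plane) (m : ℝ)) := ⟨⟨0, by simp⟩⟩

/-- For smooth realisations, the star event is a countable union of conditions on the jets along
dense sequences of larger and larger discs. -/
lemma mem_starEvent_iff {R : ℝ} {z : Plane} {ω : Ω} (h : ContDiff ℝ 3 fun x => f x ω) :
    ω ∈ starEvent f R z ↔ ∃ m : ℕ, (fun n k => fieldJet f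
      ((TopologicalSpace.denseSeq (Metric.closedBall (0 : Plane) m) n : Plane) + z) k ω)
        ∈ starTraces R (Metric.closedBall (0 : Plane) m) := by
  constructor
  · rintro ⟨x, hx, hgrad, γ, h0, h1, h2, h3⟩
    have hbdd : ∃ m : ℕ, ∀ i t, γ i t - z ∈ Metric.closedBall (0 : Plane) m := by
      have : ∀ i, ∃ M : ℝ, ∀ t, ‖γ i t - z‖ ≤ M := fun i => by
        obtain ⟨M, hM⟩ := (isCompact_range
          (f := fun t => ‖γ i t - z‖) (by fun_prop)).bddAbove
        exact ⟨M, fun t => hM ⟨t, rfl⟩⟩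
      choose M hM using this
      obtain ⟨m, hm⟩ := exists_nat_ge (∑ i, |M i|)
      refine ⟨m, fun i t => mem_closedBall_zero_iff.2 (((hM i t).trans (le_abs_self _)).trans
        (le_trans ?_ hm))⟩
      exact Finset.single_le_sum (f := fun i => |M i|) (fun _ _ => abs_nonneg _)
        (Finset.mem_univ i)
    obtain ⟨m, hm⟩ := hbdd
    let u : C(Metric.closedBall (0 : Plane) m, Option (Fin 2) → ℝ) :=
      ⟨fun y k => fieldJet f ((y : Plane) + z) k ω, continuous_pi fun k =>
        (contDiff_fieldJet h k).continuous.comp (by fun_prop)⟩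
    let δ : Fin 3 → C(unitInterval, Metric.closedBall (0 : Plane) m) := fun i =>
      ⟨fun t => ⟨γ i t - z, hm i t⟩, by fun_prop⟩
    have hδ : ∀ i t, (δ i t : Plane) = γ i t - z := fun i t => rfl
    have hu : ∀ i t k, u (δ i t) k = fieldJet f (γ i t) k ω := fun i t k => by
      change fieldJet f (γ i t - z + z) k ω = _
      rw [sub_add_cancel]
    refine ⟨m, (u, δ), ⟨fun i => Subtype.ext ?_, ?_, fun j => ?_, fun i => ?_, fun i t => ?_,
      fun i j hij s t hst => Subtype.ext ?_⟩, rfl⟩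
    · simp only [hδ, h0]
    · simp only [hδ, h0]
      rwa [mem_closedBall_iff_norm] at hx
    · simp only [hu, h0]
      simp [fieldJet, fieldGradient, hgrad]
    · simpa only [hδ, h0, dist_sub_right] using h1 i
    · simp only [hu, h0]
      exact h3 i t
    · have h4 : γ i s = γ j t := by simpa [hδ] using congrArg Subtype.val hst
      simp only [hδ, h0, h2 i j hij s t h4]
  · rintro ⟨m, ⟨u, δ⟩, ⟨h0, h1, h2, h3, h4, h5⟩, hu⟩
    have hagree : ∀ y : Metric.closedBall (0 : Plane) m,
        u y = fun k => fieldJet f ((y : Plane) + z) k ω := by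
      have hcont : Continuous fun (y : Metric.closedBall (0 : Plane) m) k =>
          fieldJet f ((y : Plane) + z) k ω := continuous_pi fun k =>
        (contDiff_fieldJet h k).continuous.comp (by fun_prop)
      exact fun y => congrFun
        ((TopologicalSpace.denseRange_denseSeq (Metric.closedBall (0 : Plane) m)).equalizer
          u.continuous hcont hu) y
    refine ⟨(δ 0 0 : Plane) + z, ?_, ?_, fun i => ⟨fun t => (δ i t : Plane) + z, by fun_prop⟩,
      fun i => ?_, fun i => ?_, fun i j hij s t hst => ?_, fun i t => ?_⟩
    · rw [mem_closedBall_iff_norm, add_sub_cancel_right]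
      exact h1
    · ext j
      have := h2 j
      rw [hagree] at this
      exact this
    · change (δ i 0 : Plane) + z = _
      rw [h0 i]
    · change R ≤ dist ((δ i 1 : Plane) + z) _
      rw [dist_add_right]
      exact h3 i
    · have h6 : (δ i s : Plane) + z = (δ j t : Plane) + z := hst
      change (δ i s : Plane) + z = _
      rw [h5 i j hij s t (Subtype.ext (add_right_cancel h6))]
    · have := h4 i t
      rw [hagree, hagree] at this
      exact this

/-- The star events are null measurable and have the same probability at all places. -/
theorem starEvent_nullMeasurableSet_and_measure_eq [MeasurableSpace Ω] {P : Measure Ω}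
    [IsProbabilityMeasure P] (hf : IsStationaryCentredGaussianField f P)
    (hs : ∀ᵐ ω ∂P, ContDiff ℝ 3 fun x => f x ω) (R : ℝ) (z : Plane) :
    NullMeasurableSet (starEvent f R z) P ∧ P (starEvent f R z) = P (starEvent f R 0) := by
  let x : ℕ × ℕ → Plane := fun p =>
    (TopologicalSpace.denseSeq (Metric.closedBall (0 : Plane) (p.1 : ℝ)) p.2 : Plane)
  let T : Set (ℕ × ℕ → Option (Fin 2) → ℝ) :=
    ⋃ m : ℕ, (fun y n => y (m, n)) ⁻¹' starTraces R (Metric.closedBall (0 : Plane) (m : ℝ))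
  have hT : AnalyticSet T := by
    refine AnalyticSet.iUnion fun m => ?_
    have : CompactSpace (Metric.closedBall (0 : Plane) (m : ℝ)) :=
      isCompact_iff_compactSpace.1 (isCompact_closedBall _ _)
    exact (analyticSet_starTraces R _).preimage (by fun_prop)
  have hlaw := fun z' => hf.identDistrib_fieldJet hs x z'
  have hTnull : ∀ z', NullMeasurableSet T (P.map fun ω p k => fieldJet f (x p + z') k ω) :=
    fun z' => hT.nullMeasurableSet _
  have hG : ∀ z', starEvent f R z' =ᵐ[P] (fun ω p k => fieldJet f (x p + z') k ω) ⁻¹' T := by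
    intro z'
    rw [eventuallyEq_set]
    filter_upwards [hs] with ω hω
    rw [mem_starEvent_iff hω, Set.mem_preimage, Set.mem_iUnion]
    rfl
  have hprob : ∀ z', P (starEvent f R z') = P.map (fun ω p k => fieldJet f (x p) k ω) T := by
    intro z'
    rw [measure_congr (hG z'), ← Measure.map_apply₀ (hlaw z').aemeasurable_fst (hTnull z'),
      (hlaw z').map_eq]
  exact ⟨(nullMeasurableSet_preimage_of_map (hlaw z).aemeasurable_fst (hTnull z)).congr
    (hG z).symm, (hprob z).trans (hprob 0).symm⟩

end

/-! ### The bound on the probability -/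

section

/-- Three of the four arms at a saddle point suffice. -/
lemma IsSaddlePoint.isStarCentre {R : ℝ} {u : Plane → ℝ} {x : Plane} (h : IsSaddlePoint R u x) :
    IsStarCentre R u x := by
  obtain ⟨-, y, γ, hy, -, hmeet, a, ha⟩ := h
  have hlev : ∀ i t, u (γ i t) = a := fun i t => ha _ (Set.mem_iUnion.2 ⟨i, t, rfl⟩)
  refine ⟨fun i => (γ i.castSucc : C(unitInterval, Plane)), fun i => (γ i.castSucc).source,
    fun i => ?_, fun i j hij s t hst => ?_, fun i t => ?_⟩
  · change R ≤ dist (γ i.castSucc 1) x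
    rw [(γ i.castSucc).target]
    exact (Metric.mem_sphere.1 (hy _)).ge
  · have hmem : γ i.castSucc s ∈ Set.range (γ i.castSucc) ∩ Set.range (γ j.castSucc) :=
      ⟨⟨s, rfl⟩, ⟨t, hst.symm⟩⟩
    rw [hmeet _ _ fun h => hij (Fin.castSucc_injective _ h)] at hmem
    exact hmem
  · have h0 := hlev i.castSucc 0
    rw [(γ i.castSucc).source] at h0
    exact (hlev i.castSucc t).trans h0.symm

/-- The points of the grid of mesh three in the first quadrant; the unit squares about them are
disjoint. -/
noncomputable def gridCentre {m : ℕ} (p : Fin m × Fin m) : Plane :=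
  !₂[3 * ((p.1 : ℕ) : ℝ), 3 * ((p.2 : ℕ) : ℝ)]

lemma closedBall_subset_unitSquare (z : Plane) : Metric.closedBall z 1 ⊆ unitSquare z :=
  fun x hx j => by
    rw [mem_closedBall_iff_norm] at hx
    exact (PiLp.norm_apply_le (x - z) j).trans hx

lemma disjoint_unitSquare_gridCentre {m : ℕ} {p q : Fin m × Fin m} (h : p ≠ q) :
    Disjoint (unitSquare (gridCentre p)) (unitSquare (gridCentre q)) := by
  have key : ∀ (a b : ℕ) (t : ℝ), |t - 3 * (a : ℝ)| ≤ 1 → |t - 3 * (b : ℝ)| ≤ 1 → a = b := by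
    intro a b t ha hb
    rw [abs_le] at ha hb
    by_contra hne
    rcases Nat.lt_or_gt_of_ne hne with hlt | hlt
    · have : (a : ℝ) + 1 ≤ b := by exact_mod_cast hlt
      linarith
    · have : (b : ℝ) + 1 ≤ a := by exact_mod_cast hlt
      linarith
  refine Set.disjoint_left.2 fun x hp hq => h (Prod.ext (Fin.ext ?_) (Fin.ext ?_))
  · exact key _ _ (x 0) (by simpa [gridCentre] using hp 0) (by simpa [gridCentre] using hq 0)
  · exact key _ _ (x 1) (by simpa [gridCentre] using hp 1) (by simpa [gridCentre] using hq 1)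

lemma norm_lt_of_mem_closedBall_gridCentre {m : ℕ} {p : Fin m × Fin m} {x : Plane}
    (hx : x ∈ Metric.closedBall (gridCentre p) 1) : ‖x‖ < 6 * m := by
  have h1 : ((p.1 : ℕ) : ℝ) + 1 ≤ m := by exact_mod_cast p.1.2
  have h2 : ((p.2 : ℕ) : ℝ) + 1 ≤ m := by exact_mod_cast p.2.2
  have h3 : ‖gridCentre p‖ ≤ 3 * ((p.1 : ℕ) : ℝ) + 3 * ((p.2 : ℕ) : ℝ) := by
    refine (norm_le_abs_add_abs _).trans_eq ?_
    simp [gridCentre]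
  have h4 := norm_le_norm_add_norm_sub' x (gridCentre p)
  rw [mem_closedBall_iff_norm] at hx
  linarith

variable {Ω : Type*} [MeasurableSpace Ω] {P : Measure Ω} [IsProbabilityMeasure P]
  {f : Plane → Ω → ℝ}

/-- Almost surely the stars centred near distinct grid points have distinct levels, so that each of
them costs its own arc of the circle of radius `ρ`. The expected number of arcs is linear in `ρ`,
and all star events have the same probability. -/
theorem exists_sq_mul_measure_starEvent_le (hf : IsStationaryCentredGaussianField f P)
    (hA : SmoothNondegenerateDecaying f P) :
    ∃ C : ℝ, 0 < C ∧ ∀ (m : ℕ) (ρ : ℝ), 1 ≤ ρ → 6 * (m : ℝ) ≤ ρ →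
      (m : ENNReal) ^ 2 * P (starEvent f (2 * ρ) 0) ≤ ENNReal.ofReal (C * ρ) := by
  obtain ⟨C, hC, hN⟩ := exists_lintegral_le_of_disjoint_arcs hf hA
  refine ⟨C, hC, fun m ρ hρ hm => ?_⟩
  obtain ⟨N, hNint, hNcard⟩ := hN ρ hρ
  have hev := fun p : Fin m × Fin m =>
    starEvent_nullMeasurableSet_and_measure_eq hf hA.smooth (2 * ρ) (gridCentre p)
  have hlevels : ∀ᵐ ω ∂P, ∀ p q : Fin m × Fin m, p ≠ q → ∀ a ∈ unitSquare (gridCentre p),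
      ∀ b ∈ unitSquare (gridCentre q), gradient (fun x => f x ω) a = 0 →
        gradient (fun x => f x ω) b = 0 → f a ω ≠ f b ω := by
    simp only [ae_all_iff, eventually_imp_distrib_left]
    exact fun p q hpq => ae_level_ne_of_disjoint hf hA (disjoint_unitSquare_gridCentre hpq)
  have hle : ∀ᵐ ω ∂P, ∑ p : Fin m × Fin m,
      (starEvent f (2 * ρ) (gridCentre p)).indicator (1 : Ω → ENNReal) ω ≤ N ω := by
    filter_upwards [hlevels, hNcard] with ω hω hJ
    classical
    let S : Finset (Fin m × Fin m) :=
      Finset.univ.filter fun p => ω ∈ starEvent f (2 * ρ) (gridCentre p)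
    have hx : ∀ p, ∃ x : Plane, p ∈ S → x ∈ Metric.closedBall (gridCentre p) 1 ∧
        gradient (fun y => f y ω) x = 0 ∧ IsStarCentre (2 * ρ) (fun y => f y ω) x := by
      intro p
      by_cases hp : p ∈ S
      · obtain ⟨x, hx⟩ := (Finset.mem_filter.1 hp).2
        exact ⟨x, fun _ => hx⟩
      · exact ⟨0, fun h => absurd h hp⟩
    choose x hx using hx
    obtain ⟨J, hcard, hJ1, hJ2⟩ := exists_disjoint_arcs_of_isStarCentre (u := fun y => f y ω) S x
      (fun p hp => (norm_lt_of_mem_closedBall_gridCentre (hx p hp).1).trans_le hm)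
      (fun p hp => (hx p hp).2.2)
      (fun p hp q hq hpq => hω p q hpq _ (closedBall_subset_unitSquare _ (hx p hp).1) _
        (closedBall_subset_unitSquare _ (hx q hq).1) (hx p hp).2.1 (hx q hq).2.1)
    have hsum : ∑ p : Fin m × Fin m,
        (starEvent f (2 * ρ) (gridCentre p)).indicator (1 : Ω → ENNReal) ω
          = (S.card : ENNReal) := by
      simp [S, Set.indicator_apply, Finset.sum_boole]
    rw [hsum]
    exact le_trans (by exact_mod_cast hcard) (hJ J hJ1 hJ2)
  calc (m : ENNReal) ^ 2 * P (starEvent f (2 * ρ) 0)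
      = ∑ p : Fin m × Fin m, P (starEvent f (2 * ρ) (gridCentre p)) := by
        simp only [(hev _).2, Finset.sum_const, Finset.card_univ, Fintype.card_prod,
          Fintype.card_fin, nsmul_eq_mul, Nat.cast_mul, sq]
    _ = ∑ p : Fin m × Fin m, ∫⁻ ω,
          (starEvent f (2 * ρ) (gridCentre p)).indicator (1 : Ω → ENNReal) ω ∂P :=
        Finset.sum_congr rfl fun p _ => (lintegral_indicator_one₀ (hev p).1).symm
    _ = ∫⁻ ω, ∑ p : Fin m × Fin m,
          (starEvent f (2 * ρ) (gridCentre p)).indicator (1 : Ω → ENNReal) ω ∂P :=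
        (lintegral_finsetSum' _ fun p _ => (aemeasurable_one.indicator₀ (hev p).1)).symm
    _ ≤ ∫⁻ ω, N ω ∂P := lintegral_mono_ae hle
    _ ≤ ENNReal.ofReal (C * ρ) := hNint

end

theorem corollary4p3 {Ω : Type*} [MeasurableSpace Ω] (P : Measure Ω) [IsProbabilityMeasure P]
    (f : Plane → Ω → ℝ) (hf : IsStationaryCentredGaussianField f P)
    (hA : SmoothNondegenerateDecaying f P) :
    ∃ c : ℝ, 0 < c ∧ ∀ R : ℝ, 0 < R →
      P {ω | ∃ x ∈ Metric.closedBall (0 : Plane) 1, IsSaddlePoint R (fun y => f y ω) x}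
        < ENNReal.ofReal (c / R) := by
  obtain ⟨C, hC, hbound⟩ := exists_sq_mul_measure_starEvent_le hf hA
  refine ⟨13 + 289 * C, by positivity, fun R hR => ?_⟩
  rcases lt_or_ge R 12 with hR12 | hR12
  · refine lt_of_le_of_lt prob_le_one ?_
    rw [ENNReal.one_lt_ofReal, one_lt_div hR]
    linarith
  -- a grid of `m²` points, with `m` comparable to `R`, fits into the disc of radius `R / 2`
  obtain ⟨m, hm⟩ : ∃ m : ℕ, m = ⌊R / 12⌋₊ := ⟨_, rfl⟩
  have hm1 : 6 * (m : ℝ) ≤ R / 2 := by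
    have := Nat.floor_le (show 0 ≤ R / 12 by positivity)
    rw [← hm] at this
    linarith
  have hm2 : R / 24 ≤ m := by
    have h1 := Nat.lt_floor_add_one (R / 12)
    have h2 : (1 : ℝ) ≤ m := by
      exact_mod_cast hm ▸ Nat.le_floor (show ((1 : ℕ) : ℝ) ≤ R / 12 by push_cast; linarith)
    rw [← hm] at h1
    linarith
  have hmain := hbound m (R / 2) (by linarith) hm1
  rw [mul_div_cancel₀ _ (two_ne_zero' ℝ)] at hmain
  have hsub : {ω | ∃ x ∈ Metric.closedBall (0 : Plane) 1, IsSaddlePoint R (fun y => f y ω) x}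
      ⊆ starEvent f R 0 := fun ω ⟨x, hx, h⟩ => ⟨x, hx, h.1, h.isStarCentre⟩
  refine (measure_mono hsub).trans_lt ?_
  have hfin : P (starEvent f R 0) ≠ ⊤ := measure_ne_top _ _
  rw [← ENNReal.ofReal_toReal hfin] at hmain ⊢
  have hmain' : (m : ℝ) ^ 2 * (P (starEvent f R 0)).toReal ≤ C * (R / 2) := by
    rw [← ENNReal.ofReal_natCast, ← ENNReal.ofReal_pow (by positivity),
      ← ENNReal.ofReal_mul (by positivity)] at hmain
    exact (ENNReal.ofReal_le_ofReal_iff (by positivity)).1 hmain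
  refine (ENNReal.ofReal_lt_ofReal_iff (by positivity)).2 ?_
  have hp : 0 ≤ (P (starEvent f R 0)).toReal := ENNReal.toReal_nonneg
  have hsq : (R / 24) ^ 2 ≤ (m : ℝ) ^ 2 := by gcongr
  have h5 := mul_le_mul_of_nonneg_right hsq hp
  rw [lt_div_iff₀ hR]
  have h6 : R * (R * (P (starEvent f R 0)).toReal) ≤ R * (288 * C) := by nlinarith
  have h7 := le_of_mul_le_mul_left h6 hR
  linarith
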